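/- Let $K$ be a field, let $A=\{u_1,\dots,u_n\}$ be a set of $n$ distinct monomials of the same degree $\delta>0$ in $K[t_1,\dots,t_d]$, let $K[A]=K[u_1,\dots,u_n]$ be the toric ring, and let $I_A$ be its toric ideal, the kernel of $K[x_1,\dots,x_n]\to K[A]$, $x_i\mapsto u_i$. Call $K[A]$ \emph{strongly Koszul} if $u_1,\dots,u_n$ is a minimal system of generators of the graded maximal ideal of $K[A]$ such that for all $1\le i_1<\dots<i_r\le n$ and all $1\le s\le r$ the colon ideal $(u_{i_1},\dots,u_{i_{s-1}}):u_{i_s}$ of $K[A]$ is generated by a subset of $\{u_1,\dots,u_n\}$. Call $K[A]$ \emph{squarefree} if it is isomorphic as a $K$-algebra to a semigroup ring generated by finitely many squarefree monomials. For an ordering $<$ of the variables $x_1,\dots,x_n$, let $<_{\rm rlex}$ be the (graded) reverse lexicographic order induced by it, let ${\rm in}_{<_{\rm rlex}}(I_A)$ be the corresponding initial ideal, and let $G(J)$ denote the minimal set of monomial generators of a monomial ideal $J$. Suppose that $K[A]$ is squarefree. (1) Suppose that $K[A]$ is strongly Koszul. Let $1\le i<j\le n$, and let $<$ be any ordering of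 the variables satisfying $$x_j<x_i<\{x_k \mid u_iu_k/u_j\in K[A],\ k\ne j\}<\text{ all other variables}.$$ Then every monomial in $G({\rm in}_{<_{\rm rlex}}(I_A))\cap(x_i)$ is quadratic. (2) Consequently, $K[A]$ is strongly Koszul if and only if for all $1\le i<j\le n$ there is an ordering $x_{i_1}<x_{i_2}<\dots<x_{i_n}$ of the variables with $\{i_1,i_2\}=\{i,j\}$ such that every monomial in $G({\rm in}_{<_{\rm rlex}}(I_A))\cap(x_{i_2})$ is quadratic. -/

import Mathlib

open MvPolynomial

namespace StronglyKoszulToric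

/-! ### The reverse lexicographic order -/

section RevLex

variable {n : ℕ}

/-- Copy of the exponent vectors `Fin n →₀ ℕ`, to carry the (graded) reverse lexicographic order
induced by an ordering of the variables. The ordering is given by `ρ : Equiv.Perm (Fin n)`, where
`ρ k` is the position of `x_k`, counted from the smallest variable: `x_k < x_l` iff `ρ k < ρ l`. -/
@[ext]
structure RevLex (ρ : Equiv.Perm (Fin n)) : Type where
  exps : Fin n →₀ ℕ

namespace RevLex

variable (ρ : Equiv.Perm (Fin n))

/-- The identification of `RevLex ρ` with `Fin n →₀ ℕ`. -/
def equiv : RevLex ρ ≃ (Fin n →₀ ℕ) := ⟨exps, mk, fun _ => rfl, fun _ => rfl⟩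

noncomputable instance : AddCommMonoid (RevLex ρ) := (equiv ρ).addCommMonoid

theorem exps_add (a b : RevLex ρ) : (a + b).exps = a.exps + b.exps := rfl

/-- The total degree of an exponent vector, followed by its exponents listed from the smallest
variable to the largest one, with the order on the exponents reversed. -/
noncomputable def key (a : RevLex ρ) : ℕ ×ₗ Lex (Fin n → ℕᵒᵈ) :=
  toLex (a.exps.degree, toLex fun p => OrderDual.toDual (a.exps (ρ.symm p)))

theorem key_injective : Function.Injective (key ρ) := by
  intro a b h
  have h1 := (Prod.mk.inj (toLex.injective h)).2
  have h2 := toLex.injective h1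
  ext k
  simpa using congrFun h2 (ρ k)

noncomputable instance : LinearOrder (RevLex ρ) :=
  LinearOrder.lift' (key ρ) (key_injective ρ)

/-- `a` is smaller than `b` iff it has smaller degree, or the degrees agree and, for the smallest
variable at which the exponents differ, the exponent in `a` is the larger one. -/
theorem lt_iff (a b : RevLex ρ) :
    a < b ↔ a.exps.degree < b.exps.degree ∨ a.exps.degree = b.exps.degree ∧
      ∃ k, (∀ l, ρ l < ρ k → a.exps l = b.exps l) ∧ b.exps k < a.exps k := by
  have : a < b ↔ key ρ a < key ρ b := Iff.rfl
  rw [this, key, key, Prod.Lex.toLex_lt_toLex]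
  refine or_congr Iff.rfl (and_congr Iff.rfl ?_)
  constructor
  · rintro ⟨p, h1, h2⟩
    refine ⟨ρ.symm p, fun l hl => ?_, h2⟩
    have := h1 (ρ l) (by simpa using hl)
    simpa using this
  · rintro ⟨k, h1, h2⟩
    refine ⟨ρ k, fun p hp => ?_, ?_⟩
    · have := h1 (ρ.symm p) (by
        have hp' : p < ρ k := hp
        simpa using hp')
      simpa using this
    · change OrderDual.toDual (a.exps (ρ.symm (ρ k))) < OrderDual.toDual (b.exps (ρ.symm (ρ k)))
      simpa using h2

instance : IsOrderedAddMonoid (RevLex ρ) where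
  add_le_add_left a b hab c := by
    rcases hab.eq_or_lt with rfl | h
    · exact le_rfl
    · refine le_of_lt ?_
      rw [lt_iff] at h ⊢
      simpa [exps_add] using h

theorem mk_monotone : Monotone (mk : (Fin n →₀ ℕ) → RevLex ρ) := by
  intro a b h
  obtain ⟨c, rfl⟩ := exists_add_of_le h
  rcases eq_or_ne c 0 with rfl | hc
  · rw [add_zero]
  · refine ((lt_iff ρ _ _).2 (Or.inl ?_)).le
    have : Finsupp.degree c ≠ 0 := by simpa [Finsupp.degree_eq_zero_iff] using hc
    simp only [map_add]
    omega

instance : WellFoundedLT (RevLex ρ) := by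
  refine ⟨RelEmbedding.wellFounded_iff_isEmpty.2 ⟨fun f => ?_⟩⟩
  obtain ⟨p, q, hpq, hle⟩ := wellQuasiOrdered_le (fun k => (f k).exps)
  have h1 : f q < f p := f.map_rel_iff.2 hpq
  exact absurd (mk_monotone ρ hle) (not_le_of_gt h1)

end RevLex

/-- The reverse lexicographic order induced by the ordering `ρ` of the variables. -/
noncomputable def revLex (ρ : Equiv.Perm (Fin n)) : MonomialOrder (Fin n) where
  syn := RevLex ρ
  toSyn := { toEquiv := (RevLex.equiv ρ).symm, map_add' := fun _ _ => rfl }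
  toSyn_monotone := fun _ _ h => RevLex.mk_monotone ρ h

end RevLex

/-! ### Initial ideals and minimal monomial generators -/

section Initial

variable {n : ℕ} {K : Type*} [Field K]

/-- The initial ideal of `I`. -/
noncomputable def initialIdeal (m : MonomialOrder (Fin n)) (I : Ideal (MvPolynomial (Fin n) K)) :
    Ideal (MvPolynomial (Fin n) K) :=
  Ideal.span (m.leadingTerm '' (I : Set (MvPolynomial (Fin n) K)))

/-- `G(J)`, the minimal set of monomial generators of a monomial ideal `J`: the monomials of `J`
that are minimal with respect to divisibility. -/
def minimalGenerators (J : Ideal (MvPolynomial (Fin n) K)) : Set (MvPolynomial (Fin n) K) :=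
  {g | ∃ e : Fin n →₀ ℕ, Minimal (fun e' => monomial e' (1 : K) ∈ J) e ∧ g = monomial e 1}

end Initial

/-! ### Toric rings -/

section Toric

variable {n d : ℕ} (K : Type*) [Field K]

/-- The monomial `u_i = t^{a_i}`. -/
noncomputable def gen (a : Fin n → Fin d →₀ ℕ) (i : Fin n) : MvPolynomial (Fin d) K :=
  monomial (a i) 1

/-- The toric ring `K[A] = K[u_1, …, u_n]`. -/
noncomputable def toricRing (a : Fin n → Fin d →₀ ℕ) : Subalgebra K (MvPolynomial (Fin d) K) :=
  Algebra.adjoin K (Set.range (gen K a))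

/-- The monomial `u_i` as an element of `K[A]`. -/
noncomputable def toricGen (a : Fin n → Fin d →₀ ℕ) (i : Fin n) : toricRing K a :=
  ⟨gen K a i, Algebra.subset_adjoin ⟨i, rfl⟩⟩

/-- The toric ideal `I_A`, the kernel of `x_i ↦ u_i`. -/
noncomputable def toricIdeal (a : Fin n → Fin d →₀ ℕ) : Ideal (MvPolynomial (Fin n) K) :=
  RingHom.ker (aeval (gen K a) : MvPolynomial (Fin n) K →ₐ[K] MvPolynomial (Fin d) K)

/-- The graded maximal ideal of `K[A]`: the elements with constant term zero. -/
noncomputable def gradedMaximalIdeal (a : Fin n → Fin d →₀ ℕ) : Ideal (toricRing K a) :=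
  (RingHom.ker (constantCoeff : MvPolynomial (Fin d) K →+* K)).comap (toricRing K a).val

/-- `u_1, …, u_n` is a minimal system of generators of `𝔪` such that, whenever
`i_1 < ⋯ < i_r`, the ideals `(u_{i_1}, …, u_{i_{j-1}}) : u_{i_j}` are generated by subsets of
`{u_1, …, u_n}`. -/
structure IsStronglyKoszulSystem {R : Type*} [CommRing R] (𝔪 : Ideal R) (u : Fin n → R) :
    Prop where
  span_eq : Ideal.span (Set.range u) = 𝔪
  minimal : ∀ k, u k ∉ Ideal.span (u '' {k}ᶜ)
  colon : ∀ (S : Set (Fin n)) (k : Fin n), (∀ s ∈ S, s < k) →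
    ∃ T : Set (Fin n), (Ideal.span (u '' S)).colon {u k} = Ideal.span (u '' T)

/-- `K[A]` is strongly Koszul (with respect to its monomial generators `u_1, …, u_n`). -/
def IsStronglyKoszul (a : Fin n → Fin d →₀ ℕ) : Prop :=
  IsStronglyKoszulSystem (gradedMaximalIdeal K a) (toricGen K a)

/-- `K[A]` is squarefree: it is isomorphic, as a `K`-algebra, to a semigroup ring generated by
squarefree monomials. -/
def IsSquarefreeToric (a : Fin n → Fin d →₀ ℕ) : Prop :=
  ∃ (N e : ℕ) (b : Fin N → Fin e →₀ ℕ), (∀ j s, b j s ≤ 1) ∧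
    Nonempty (toricRing K a ≃ₐ[K] toricRing K b)

/-- The set of all `k ≠ j` with `u_i u_k / u_j ∈ K[A]`. -/
def exchangeSet (a : Fin n → Fin d →₀ ℕ) (i j : Fin n) : Set (Fin n) :=
  {k | k ≠ j ∧ ∃ w ∈ toricRing K a, gen K a i * gen K a k = gen K a j * w}

/-- `x_j < x_i < {x_k | k ∈ exchangeSet} < all other variables`. -/
structure IsExchangeOrdering (a : Fin n → Fin d →₀ ℕ) (i j : Fin n) (ρ : Equiv.Perm (Fin n)) :
    Prop where
  lt : ρ j < ρ i
  lt_exchange : ∀ k ∈ exchangeSet K a i j, ρ i < ρ k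
  lt_other : ∀ l, l ≠ i → l ≠ j → l ∉ exchangeSet K a i j → ρ i < ρ l
  exchange_lt_other : ∀ k ∈ exchangeSet K a i j, ∀ l, l ≠ i → l ≠ j → l ∉ exchangeSet K a i j →
    ρ k < ρ l

/-- Every monomial in `G(in(I_A)) ∩ (x_i)` is quadratic, where the initial ideal is taken for the
reverse lexicographic order induced by `ρ`. -/
def QuadraticAt (a : Fin n → Fin d →₀ ℕ) (ρ : Equiv.Perm (Fin n)) (i : Fin n) : Prop :=
  ∀ g ∈ minimalGenerators (initialIdeal (revLex ρ) (toricIdeal K a)),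
    g ∈ Ideal.span {(X i : MvPolynomial (Fin n) K)} → g.totalDegree = 2

end Toric

end StronglyKoszulToric

/-!
Strong Koszulness says that every colon ideal `(u_i) : u_j` is generated by variables, a condition
on the exponents of each pair `i ≠ j`. When `x_j < x_i` are the two smallest variables, a minimal
generator of the initial ideal divisible by `x_i` records that `u_j` divides a product of
generators none of which is `u_j`; this turns quadratic generators into the condition for the pair
`i, j`, and conversely.

Squarefreeness enters only through the rigidity of squares: `u_i ^ 2 = u_k u_l` forces `k = i`. The
isomorphism `φ` onto a ring `K[B]` generated by squarefree monomials need not respect the origins.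
Polynomials of degree at most `k` in the `u_i` form a complement of `𝔪 ^ (k + 1)` for the graded
maximal ideal `𝔪` of `K[A]`. For the graded maximal ideal `𝔫` of `K[B]`, the quotient by the
`k`-th power is no larger than the one for any other `K`-point of `K[B]`, because the monomials
outside `𝔫 ^ k` span modulo the `k`-th power of the ideal of the other point. Comparing dimensions,
the images of these polynomials form a complement of `𝔫 ^ (k + 1)`. After translating the `φ(u_i)`
into `𝔫`, a relation `u_i ^ 2 = u_k u_l` therefore yields `f ^ 2 = g h` for the linear parts, which
are combinations of squarefree monomials, hence squarefree polynomials; so `f` is a multiple of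
`g`, contradicting the independence of the `φ(u_i)` modulo `𝔫 ^ 2`.
-/

namespace StronglyKoszulToric

open scoped Pointwise

section Configuration

open Finsupp (single weight)

variable {ι G : Type*} [AddCommMonoid G] {a : ι → G}

/-- The affine monoid `ℕA` generated by a configuration `a`; its elements are the exponents of the
monomials of the toric ring. -/
def expMonoid (a : ι → G) : AddSubmonoid G := AddSubmonoid.closure (Set.range a)

/-- Divisibility of monomials in the toric ring, written on exponents: `y - x` lies in `ℕA`. -/
def Divides (a : ι → G) (x y : G) : Prop := ∃ z ∈ expMonoid a, x + z = y

/-- The ideal `(u_i) : u_j` is generated by variables, written on exponents: whenever `u_i` divides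
`t^w u_j`, some `u_k` dividing `t^w` already has `u_i ∣ u_k u_j`, with a quotient `u_l`. -/
def Exchanges (a : ι → G) (i j : ι) : Prop :=
  ∀ w ∈ expMonoid a, Divides a (a i) (w + a j) →
    ∃ k l, Divides a (a k) w ∧ a k + a j = a i + a l

/-- The square of a generator is not a product of two generators in another way. -/
def SquaresRigid (a : ι → G) : Prop := ∀ i k l, a i + a i = a k + a l → k = i

/-- The toric ideal is homogeneous for the standard grading: the number of generators in a product
depends only on the product. -/
def IsHomogeneousConfiguration (a : ι → G) : Prop :=
  ∀ ⦃e f : ι →₀ ℕ⦄, weight a e = weight a f → e.degree = f.degree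

theorem apply_mem_expMonoid (a : ι → G) (i : ι) : a i ∈ expMonoid a :=
  AddSubmonoid.subset_closure ⟨i, rfl⟩

theorem mem_expMonoid_iff {w : G} : w ∈ expMonoid a ↔ ∃ e : ι →₀ ℕ, weight a e = w :=
  AddSubmonoid.mem_closure_range_iff.trans (exists_congr fun _ => eq_comm)

theorem weight_mem_expMonoid (a : ι → G) (e : ι →₀ ℕ) : weight a e ∈ expMonoid a :=
  mem_expMonoid_iff.2 ⟨e, rfl⟩

theorem weight_single_one_add (a : ι → G) (i : ι) (e : ι →₀ ℕ) :
    weight a (single i 1 + e) = a i + weight a e := by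
  rw [map_add, Finsupp.weight_single, one_smul]

theorem exists_single_one_add_eq {e : ι →₀ ℕ} {i : ι} (h : 0 < e i) :
    ∃ f, single i 1 + f = e :=
  ⟨e - single i 1, add_tsub_cancel_of_le (Finsupp.single_le_iff.2 h)⟩

theorem exists_single_one_eq_of_degree_eq_one {e : ι →₀ ℕ} (h : e.degree = 1) :
    ∃ k, single k 1 = e :=
  Finsupp.range_single_one.ge h

theorem exists_single_one_add_single_one_eq {e : ι →₀ ℕ} {i : ι} (h : e.degree = 2)
    (hi : 0 < e i) : ∃ k, single i 1 + single k 1 = e := by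
  obtain ⟨f, rfl⟩ := exists_single_one_add_eq hi
  rw [map_add, Finsupp.degree_single] at h
  obtain ⟨k, rfl⟩ := exists_single_one_eq_of_degree_eq_one (e := f) (by lia)
  exact ⟨k, rfl⟩

theorem Divides.refl (a : ι → G) (x : G) : Divides a x x := ⟨0, zero_mem _, add_zero x⟩

theorem Divides.add_right {x y z : G} (h : Divides a x y) (hz : z ∈ expMonoid a) :
    Divides a x (y + z) := by
  obtain ⟨v, hv, rfl⟩ := h
  exact ⟨v + z, add_mem hv hz, (add_assoc _ _ _).symm⟩

theorem Divides.add_left {x y z : G} (h : Divides a x y) (hz : z ∈ expMonoid a) :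
    Divides a x (z + y) :=
  add_comm y z ▸ h.add_right hz

theorem divides_iff_exists_weight {i : ι} {w : G} :
    Divides a (a i) w ↔ ∃ e, weight a (single i 1 + e) = w := by
  simp only [Divides, mem_expMonoid_iff, exists_exists_eq_and, weight_single_one_add]

theorem divides_weight {i : ι} {e : ι →₀ ℕ} (h : 0 < e i) : Divides a (a i) (weight a e) := by
  obtain ⟨f, rfl⟩ := exists_single_one_add_eq h
  exact divides_iff_exists_weight.2 ⟨f, rfl⟩

theorem eq_zero_or_exists_divides {w : G} (hw : w ∈ expMonoid a) :
    w = 0 ∨ ∃ i, Divides a (a i) w := by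
  obtain ⟨e, rfl⟩ := mem_expMonoid_iff.1 hw
  rcases eq_or_ne e 0 with rfl | he
  · exact Or.inl (map_zero _)
  · obtain ⟨i, hi⟩ := Finsupp.ne_iff.1 he
    exact Or.inr ⟨i, divides_weight (Nat.pos_of_ne_zero hi)⟩

namespace IsHomogeneousConfiguration

variable (ha : IsHomogeneousConfiguration a)
include ha

theorem exists_eq_of_add_eq_add {i j k : ι} {w : G} (hw : w ∈ expMonoid a)
    (h : a k + w = a i + a j) : ∃ l, a l = w := by
  obtain ⟨e, rfl⟩ := mem_expMonoid_iff.1 hw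
  have hdeg : (single k 1 + e).degree = (single i 1 + single j 1).degree :=
    ha (by simpa only [weight_single_one_add, Finsupp.weight_single, one_smul] using h)
  simp only [map_add, Finsupp.degree_single] at hdeg
  obtain ⟨l, rfl⟩ := exists_single_one_eq_of_degree_eq_one (e := e) (by lia)
  exact ⟨l, by rw [Finsupp.weight_single, one_smul]⟩

theorem eq_of_divides {i j : ι} (h : Divides a (a i) (a j)) : a i = a j := by
  obtain ⟨e, he⟩ := divides_iff_exists_weight.1 h
  have hdeg : (single i 1 + e).degree = (single j 1).degree :=
    ha (by rw [he, Finsupp.weight_single, one_smul])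
  simp only [map_add, Finsupp.degree_single] at hdeg
  obtain rfl : e = 0 := (Finsupp.degree_eq_zero_iff e).1 (by lia)
  rw [← he, weight_single_one_add, map_zero, add_zero]

theorem not_divides_zero (i : ι) : ¬ Divides a (a i) 0 := by
  intro h
  obtain ⟨e, he⟩ := divides_iff_exists_weight.1 h
  have hdeg := ha (he.trans (map_zero (weight a)).symm)
  simp only [map_add, Finsupp.degree_single, map_zero] at hdeg
  lia

theorem apply_ne_zero (i : ι) : a i ≠ 0 := fun h => ha.not_divides_zero i (h ▸ Divides.refl a _)

end IsHomogeneousConfiguration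

theorem SquaresRigid.injective (ha : SquaresRigid a) : Function.Injective a := fun i k h =>
  (ha i k k (by rw [h])).symm

theorem Exchanges.symm [IsCancelAdd G] {i j : ι} (h : Exchanges a i j) : Exchanges a j i := by
  rintro w hw ⟨v, hv, hvw⟩
  obtain ⟨k, l, ⟨x, hx, rfl⟩, hkl⟩ := h v hv ⟨w, hw, by rw [add_comm v, hvw, add_comm]⟩
  refine ⟨l, k, ⟨x, hx, add_left_cancel (a := a i) ?_⟩, by rw [add_comm, ← hkl, add_comm]⟩
  calc a i + (a l + x) = a k + a j + x := by rw [← add_assoc, hkl]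
    _ = a j + (a k + x) := by rw [add_comm (a k), add_assoc]
    _ = a i + w := by rw [hvw, add_comm]

instance [IsCancelAdd G] : Std.Symm (Exchanges a) := ⟨fun _ _ => Exchanges.symm⟩

-- Factoring `t^v` into generators, one passes to the colon ideal by one generator at a time.
theorem divides_or_exists_divides_of_divides_add (h : Pairwise (Exchanges a)) {v w : G}
    (hv : v ∈ expMonoid a) (hw : w ∈ expMonoid a) {j : ι} (hj : Divides a (a j) (w + v)) :
    Divides a (a j) v ∨ ∃ k, Divides a (a k) w ∧ Divides a (a j) (a k + v) := by
  induction hv using AddSubmonoid.closure_induction_left generalizing j with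
  | zero => exact Or.inr ⟨j, by rwa [add_zero] at hj, by simpa using Divides.refl a (a j)⟩
  | add_left _ hl y hy ih =>
    obtain ⟨l, rfl⟩ := hl
    obtain rfl | hjl := eq_or_ne j l
    · exact Or.inl ⟨y, hy, rfl⟩
    obtain ⟨k, m, hk, hkm⟩ := h hjl (w + y) (add_mem hw hy) (by rwa [add_right_comm, add_assoc])
    have divides_of_divides {z : G} (hz : Divides a (a k) z) : Divides a (a j) (a l + z) := by
      obtain ⟨x, hx, rfl⟩ := hz
      exact ⟨a m + x, add_mem (apply_mem_expMonoid a m) hx, by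
        rw [← add_assoc, ← hkm, add_comm (a k), add_assoc]⟩
    refine (ih hk).imp divides_of_divides fun ⟨q, hq, hqk⟩ => ⟨q, hq, ?_⟩
    rw [add_left_comm]
    exact divides_of_divides hqk

theorem divides_add_of_divides_double_add (h : Pairwise (Exchanges a))
    (ha : IsHomogeneousConfiguration a) (hr : SquaresRigid a) {i j : ι} {v : G}
    (hv : v ∈ expMonoid a) (hj : Divides a (a j) (a i + a i + v)) : Divides a (a j) (a i + v) := by
  have hi := apply_mem_expMonoid a i
  rcases divides_or_exists_divides_of_divides_add h hv (add_mem hi hi) hj with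
    hjv | ⟨k, ⟨w, hw, hkw⟩, hjk⟩
  · exact hjv.add_left hi
  · obtain ⟨l, rfl⟩ := ha.exists_eq_of_add_eq_add hw hkw
    rwa [hr i k l hkw.symm] at hjk

end Configuration

theorem isHomogeneousConfiguration_of_degree_eq {ι σ : Type*} {a : ι → σ →₀ ℕ} {δ : ℕ}
    (hδ : 0 < δ) (hdeg : ∀ i, (a i).degree = δ) : IsHomogeneousConfiguration a := by
  have degree_weight (e : ι →₀ ℕ) : (Finsupp.weight a e).degree = e.degree * δ := by
    simp only [Finsupp.weight_apply, Finsupp.sum, map_sum, map_nsmul, hdeg, smul_eq_mul,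
      Finsupp.degree_apply, Finset.sum_mul]
  intro e f h
  refine Nat.eq_of_mul_eq_mul_right hδ ?_
  rw [← degree_weight, ← degree_weight, h]

section StandardMonomials

open Finsupp (single weight)

variable {σ G : Type*} [AddCommMonoid G] {m : MonomialOrder σ} {a : σ → G}

/-- The monomial `x^e` is not standard: a smaller monomial has the same image in the toric ring. -/
def IsNonstandard (m : MonomialOrder σ) (a : σ → G) (e : σ →₀ ℕ) : Prop :=
  ∃ e', weight a e' = weight a e ∧ m.toSyn e' < m.toSyn e

theorem IsNonstandard.mono {e f : σ →₀ ℕ} (h : IsNonstandard m a e) (hef : e ≤ f) :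
    IsNonstandard m a f := by
  obtain ⟨x, rfl⟩ := exists_add_of_le hef
  obtain ⟨e', hw, hlt⟩ := h
  exact ⟨e' + x, by rw [map_add, hw, map_add], by simpa only [map_add, add_lt_add_iff_right]⟩

theorem exists_weight_eq_not_isNonstandard {w : G} (hw : w ∈ expMonoid a) :
    ∃ e, weight a e = w ∧ ¬ IsNonstandard m a e := by
  obtain ⟨e, he, hmin⟩ := (InvImage.wf m.toSyn wellFounded_lt).has_min {e | weight a e = w}
    (mem_expMonoid_iff.1 hw)
  exact ⟨e, he, fun ⟨e', hw', hlt⟩ => hmin e' (hw'.trans he) hlt⟩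

-- A variable common to the two monomials could be cancelled from both.
theorem exists_weight_eq_of_minimal_isNonstandard [IsCancelAdd G] {e : σ →₀ ℕ}
    (he : Minimal (IsNonstandard m a) e) :
    ∃ e', weight a e' = weight a e ∧ m.toSyn e' < m.toSyn e ∧ ∀ k, 0 < e k → e' k = 0 := by
  obtain ⟨e', hw, hlt⟩ := he.prop
  refine ⟨e', hw, hlt, fun k hk => ?_⟩
  by_contra hk'
  obtain ⟨f, rfl⟩ := exists_single_one_add_eq hk
  obtain ⟨f', rfl⟩ := exists_single_one_add_eq (Nat.pos_of_ne_zero hk')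
  rw [map_add, map_add, add_lt_add_iff_left] at hlt
  rw [weight_single_one_add, weight_single_one_add] at hw
  have hle := he.le_of_le ⟨f', add_left_cancel hw, hlt⟩ le_add_self k
  simp at hle

end StandardMonomials

section InitialIdeal

open Finsupp (weight)

variable {n d : ℕ} {K : Type*} [Field K] {a : Fin n → Fin d →₀ ℕ}

theorem aeval_gen_monomial (e : Fin n →₀ ℕ) (c : K) :
    aeval (gen K a) (monomial e c) = monomial (weight a e) c := by
  simp only [aeval_monomial, algebraMap_eq, gen, monomial_pow, one_pow, Finsupp.weight_apply,
    monomial_finsupp_sum_index]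

theorem coeff_aeval_gen (f : MvPolynomial (Fin n) K) (w : Fin d →₀ ℕ) :
    coeff w (aeval (gen K a) f) = ∑ e ∈ f.support, if weight a e = w then coeff e f else 0 := by
  conv_lhs => rw [f.as_sum, map_sum, coeff_sum]
  simp only [aeval_gen_monomial, coeff_monomial]

theorem isNonstandard_degree_of_mem_toricIdeal {m : MonomialOrder (Fin n)}
    {f : MvPolynomial (Fin n) K} (hf : f ∈ toricIdeal K a) (h0 : f ≠ 0) :
    IsNonstandard m a (m.degree f) := by
  by_contra hstd
  have weight_ne : ∀ e ∈ f.support, e ≠ m.degree f → weight a e ≠ weight a (m.degree f) :=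
    fun e he hne hw => hstd ⟨e, hw, (m.le_degree he).lt_of_ne (m.toSyn.injective.ne hne)⟩
  have hmem := m.degree_mem_support h0
  have hcoeff : coeff (weight a (m.degree f)) (aeval (gen K a) f) = coeff (m.degree f) f := by
    rw [coeff_aeval_gen, Finset.sum_eq_single_of_mem _ hmem
      fun e he hne => if_neg (weight_ne e he hne), if_pos rfl]
  rw [show aeval (gen K a) f = 0 from hf, coeff_zero] at hcoeff
  exact mem_support_iff.1 hmem hcoeff.symm

theorem monomial_mem_initialIdeal_iff {m : MonomialOrder (Fin n)} {e : Fin n →₀ ℕ} :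
    monomial e (1 : K) ∈ initialIdeal m (toricIdeal K a) ↔ IsNonstandard m a e := by
  classical
  rw [initialIdeal, m.span_leadingTerm_eq_span_monomial',
    ← Set.image_image (fun s => monomial s (1 : K)) m.degree, mem_ideal_span_monomial_image,
    support_monomial, if_neg one_ne_zero]
  simp only [Finset.mem_singleton, forall_eq]
  constructor
  · rintro ⟨_, ⟨f, ⟨hf, h0⟩, rfl⟩, hle⟩
    exact (isNonstandard_degree_of_mem_toricIdeal hf h0).mono hle
  · rintro ⟨e', hw, hlt⟩
    have hdeg : m.degree (monomial e (1 : K) - monomial e' 1) = e := by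
      rw [m.degree_sub_of_lt] <;> simp [m.degree_monomial, hlt]
    refine ⟨e, ⟨monomial e 1 - monomial e' 1, ⟨?_, fun h => hlt.ne ?_⟩, hdeg⟩, le_rfl⟩
    · change aeval (gen K a) _ = 0
      rw [map_sub, aeval_gen_monomial, aeval_gen_monomial, hw, sub_self]
    · rw [monomial_left_injective one_ne_zero (sub_eq_zero.1 h)]

theorem quadraticAt_iff {ρ : Equiv.Perm (Fin n)} {i : Fin n} :
    QuadraticAt K a ρ i ↔
      ∀ e, Minimal (IsNonstandard (revLex ρ) a) e → 0 < e i → e.degree = 2 := by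
  have mem_span_X_iff (e : Fin n →₀ ℕ) :
      monomial e (1 : K) ∈ Ideal.span {(X i : MvPolynomial (Fin n) K)} ↔ 0 < e i := by
    rw [Ideal.mem_span_singleton, X, monomial_dvd_monomial]
    simp [Nat.pos_iff_ne_zero, Nat.one_le_iff_ne_zero]
  have totalDegree_eq (e : Fin n →₀ ℕ) : (monomial e (1 : K)).totalDegree = e.degree :=
    totalDegree_monomial e one_ne_zero
  simp only [QuadraticAt, minimalGenerators, monomial_mem_initialIdeal_iff, Set.mem_ofPred_eq,
    forall_exists_index, and_imp]
  constructor
  · intro h e he hi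
    exact totalDegree_eq e ▸ h _ e he rfl ((mem_span_X_iff e).2 hi)
  · rintro h _ e he rfl hi
    exact (totalDegree_eq e).trans (h e he ((mem_span_X_iff e).1 hi))

end InitialIdeal

section RevLex

open Finsupp (single weight)

variable {n : ℕ} {ρ : Equiv.Perm (Fin n)} {G : Type*} [AddCommMonoid G] {a : Fin n → G}

/-- `x_p` and `x_q` are the smallest and the second smallest variable. -/
structure IsTwoSmallest (ρ : Equiv.Perm (Fin n)) (p q : Fin n) : Prop where
  lt : ρ p < ρ q
  lt_other : ∀ l, l ≠ p → l ≠ q → ρ q < ρ l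

theorem IsTwoSmallest.eq_of_le {p q l : Fin n} (h : IsTwoSmallest ρ p q) (hl : ρ l ≤ ρ p) :
    l = p := by
  by_contra hlp
  obtain rfl | hlq := eq_or_ne l q
  · exact hl.not_gt h.lt
  · exact hl.not_gt (h.lt.trans (h.lt_other l hlp hlq))

theorem isTwoSmallest_iff {p q : Fin n} :
    IsTwoSmallest ρ p q ↔ (ρ p : ℕ) = 0 ∧ (ρ q : ℕ) = 1 := by
  constructor
  · intro h
    have hlt : (ρ p : ℕ) < ρ q := h.lt
    obtain ⟨k, hk⟩ := ρ.surjective ⟨0, by lia⟩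
    obtain rfl : k = p := h.eq_of_le (by simp [hk, Fin.le_def])
    refine ⟨by simp [hk], le_antisymm (not_lt.1 fun hq => ?_) (by lia)⟩
    obtain ⟨l, hl⟩ := ρ.surjective ⟨1, by lia⟩
    refine (Fin.lt_def.1 (h.lt_other l ?_ ?_)).not_gt (by simpa [hl] using hq)
    all_goals rintro rfl; simp [hl] at hk hq
  · rintro ⟨hp, hq⟩
    refine ⟨by rw [Fin.lt_def]; lia, fun l hlp hlq => ?_⟩
    have := Fin.val_ne_of_ne (ρ.injective.ne hlp)
    have := Fin.val_ne_of_ne (ρ.injective.ne hlq)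
    rw [Fin.lt_def]
    lia

theorem revLex_toSyn_lt_iff {e f : Fin n →₀ ℕ} :
    (revLex ρ).toSyn e < (revLex ρ).toSyn f ↔ e.degree < f.degree ∨ e.degree = f.degree ∧
      ∃ k, (∀ l, ρ l < ρ k → e l = f l) ∧ f k < e k :=
  RevLex.lt_iff ρ ⟨e⟩ ⟨f⟩

theorem revLex_toSyn_lt_of_degree_eq {e f : Fin n →₀ ℕ} (h : e.degree = f.degree) {k : Fin n}
    (he : 0 < e k) (hf : ∀ l, ρ l ≤ ρ k → f l = 0) :
    (revLex ρ).toSyn e < (revLex ρ).toSyn f := by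
  obtain ⟨q, hq, hmin⟩ := e.support.exists_min_image ρ ⟨k, Finsupp.mem_support_iff.2 he.ne'⟩
  have hqk : ρ q ≤ ρ k := hmin k (Finsupp.mem_support_iff.2 he.ne')
  refine revLex_toSyn_lt_iff.2 (Or.inr ⟨h, q, fun l hl => ?_, ?_⟩)
  · rw [hf l (hl.le.trans hqk)]
    by_contra hl0
    exact hl.not_ge (hmin l (Finsupp.mem_support_iff.2 hl0))
  · rw [hf q hqk]
    exact Nat.pos_of_ne_zero (Finsupp.mem_support_iff.1 hq)

theorem isNonstandard_of_divides (ha : IsHomogeneousConfiguration a) {e : Fin n →₀ ℕ} {k : Fin n}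
    (hdvd : Divides a (a k) (weight a e)) (he : ∀ l, ρ l ≤ ρ k → e l = 0) :
    IsNonstandard (revLex ρ) a e := by
  obtain ⟨f, hf⟩ := divides_iff_exists_weight.1 hdvd
  exact ⟨_, hf, revLex_toSyn_lt_of_degree_eq (ha hf) (by simp) he⟩

theorem IsTwoSmallest.exists_weight_eq_of_minimal [IsCancelAdd G]
    (ha : IsHomogeneousConfiguration a) {p q : Fin n} (hpq : IsTwoSmallest ρ p q) {e : Fin n →₀ ℕ}
    (he : Minimal (IsNonstandard (revLex ρ) a) e) (heq : 0 < e q) :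
    e p = 0 ∧ ∃ e', weight a e' = weight a e ∧ 0 < e' p := by
  obtain ⟨e', hw, hlt, hdisj⟩ := exists_weight_eq_of_minimal_isNonstandard he
  obtain hdeg | ⟨-, k, heq_below, hk⟩ := revLex_toSyn_lt_iff.1 hlt
  · exact absurd (ha hw) hdeg.ne
  have hek : e k = 0 := Nat.eq_zero_of_not_pos fun h => by simp [hdisj k h] at hk
  have hkq : k ≠ q := by
    rintro rfl
    lia
  obtain rfl : k = p := by
    by_contra hkp
    have := heq_below q (hpq.lt_other k hkp hkq)
    rw [hdisj q heq] at this
    lia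
  exact ⟨hek, e', hw, by lia⟩

end RevLex

section ToricRing

open Finsupp (weight)

variable {n d : ℕ} {K : Type*} [Field K] {a : Fin n → Fin d →₀ ℕ}

theorem mem_toricRing_iff {f : MvPolynomial (Fin d) K} :
    f ∈ toricRing K a ↔ f ∈ restrictSupport K (expMonoid a : Set (Fin d →₀ ℕ)) := by
  rw [toricRing, Algebra.adjoin_range_eq_range_aeval, AlgHom.mem_range]
  constructor
  · rintro ⟨F, rfl⟩
    rw [F.as_sum, map_sum]
    refine sum_mem fun e _ => ?_
    rw [aeval_gen_monomial, monomial_mem_restrictSupport]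
    exact Or.inl (weight_mem_expMonoid a e)
  · intro hf
    rw [f.as_sum]
    refine (aeval (gen K a)).range.sum_mem fun m hm => ?_
    obtain ⟨e, rfl⟩ := mem_expMonoid_iff.1 ((mem_restrictSupport_iff K).1 hf hm)
    exact ⟨_, aeval_gen_monomial e _⟩

theorem mem_expMonoid_of_mem_support (f : toricRing K a) {m : Fin d →₀ ℕ}
    (hm : m ∈ f.1.support) : m ∈ expMonoid a :=
  (mem_restrictSupport_iff K).1 (mem_toricRing_iff.1 f.2) hm

/-- The monomial `t^m`, for `m` in the affine monoid, as an element of the toric ring. -/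
noncomputable def toricMonomial (K : Type*) [Field K] {m : Fin d →₀ ℕ} (hm : m ∈ expMonoid a) :
    toricRing K a :=
  ⟨monomial m 1, mem_toricRing_iff.2 ((monomial_mem_restrictSupport K).2 (Or.inl hm))⟩

@[simp]
theorem coe_toricMonomial {m : Fin d →₀ ℕ} (hm : m ∈ expMonoid a) :
    (toricMonomial K hm : MvPolynomial (Fin d) K) = monomial m 1 := rfl

@[simp]
theorem coe_toricGen (i : Fin n) :
    (toricGen K a i : MvPolynomial (Fin d) K) = monomial (a i) 1 := rfl

theorem support_toricMonomial {m : Fin d →₀ ℕ} (hm : m ∈ expMonoid a) :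
    (toricMonomial K hm).1.support = {m} := by
  classical
  rw [coe_toricMonomial, support_monomial, if_neg one_ne_zero]

theorem toricMonomial_add {m m' : Fin d →₀ ℕ} (hm : m ∈ expMonoid a) (hm' : m' ∈ expMonoid a) :
    toricMonomial K (add_mem hm hm') = toricMonomial K hm * toricMonomial K hm' :=
  Subtype.ext (by simp [monomial_mul])

theorem mem_of_toricMonomial_mem {W : Submodule K (toricRing K a)} {f : toricRing K a}
    (h : ∀ m (hm : m ∈ expMonoid a), m ∈ f.1.support → toricMonomial K hm ∈ W) : f ∈ W := by
  have hf : f = ∑ m : f.1.support, f.1.coeff m •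
      toricMonomial K (mem_expMonoid_of_mem_support f m.2) := by
    apply Subtype.ext
    simp only [AddSubmonoidClass.coe_finsetSum, SetLike.val_smul, coe_toricMonomial,
      smul_monomial, smul_eq_mul, mul_one]
    exact f.1.as_sum.trans (Finset.sum_coe_sort _ fun m => monomial m (coeff m f.1)).symm
  rw [hf]
  exact sum_mem fun m _ => W.smul_mem _ (h _ _ m.2)

theorem mem_span_toricGen_iff {S : Set (Fin n)} {f : toricRing K a} :
    f ∈ Ideal.span (toricGen K a '' S) ↔ ∀ m ∈ f.1.support, ∃ s ∈ S, Divides a (a s) m := by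
  classical
  constructor
  · intro hf
    induction hf using Submodule.span_induction with
    | mem x hx =>
      obtain ⟨s, hs, rfl⟩ := hx
      intro m hm
      rw [Finset.mem_singleton.1 (support_monomial_subset hm)]
      exact ⟨s, hs, Divides.refl a _⟩
    | zero => simp
    | add x y _ _ hx hy =>
      exact fun m hm => (Finset.mem_union.1 (support_add hm)).elim (hx m) (hy m)
    | smul r x _ hx =>
      intro m hm
      obtain ⟨p, hp, q, hq, rfl⟩ := Finset.mem_add.1 (support_mul r.1 x.1 hm)
      obtain ⟨s, hs, h⟩ := hx q hq
      exact ⟨s, hs, h.add_left (mem_expMonoid_of_mem_support r hp)⟩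
  · intro h
    refine mem_of_toricMonomial_mem (W := (Ideal.span _).restrictScalars K) fun m hm hmf => ?_
    obtain ⟨s, hs, v, hv, rfl⟩ := h m hmf
    rw [toricMonomial_add (apply_mem_expMonoid a s) hv]
    exact Ideal.mul_mem_right _ _ (Ideal.subset_span ⟨s, hs, rfl⟩)

theorem mem_colon_toricGen_iff {S : Set (Fin n)} {k : Fin n} {f : toricRing K a} :
    f ∈ (Ideal.span (toricGen K a '' S)).colon {toricGen K a k} ↔
      ∀ m ∈ f.1.support, ∃ s ∈ S, Divides a (a s) (m + a k) := by
  rw [Submodule.mem_colon_singleton, smul_eq_mul, mem_span_toricGen_iff]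
  have hsupp : (f * toricGen K a k).1.support = f.1.support.map (addRightEmbedding (a k)) :=
    AddMonoidAlgebra.support_coeff_mul_single f.1 _ (by simp) _
  simp only [hsupp, Finset.mem_map, addRightEmbedding_apply, forall_exists_index, and_imp,
    forall_apply_eq_imp_iff₂]

theorem mem_exchangeSet_iff {i j k : Fin n} :
    k ∈ exchangeSet K a i j ↔ k ≠ j ∧ Divides a (a j) (a i + a k) := by
  have hsum : a i + a k ∈ expMonoid a :=
    add_mem (apply_mem_expMonoid a i) (apply_mem_expMonoid a k)
  have hspan := mem_span_toricGen_iff (S := {j}) (f := toricMonomial K hsum)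
  rw [support_toricMonomial, Set.image_singleton, Ideal.mem_span_singleton] at hspan
  simp only [Finset.mem_singleton, forall_eq, Set.mem_singleton_iff, exists_eq_left] at hspan
  refine and_congr Iff.rfl (Iff.trans ⟨?_, ?_⟩ hspan)
  · rintro ⟨w, hw, h⟩
    exact ⟨⟨w, hw⟩, Subtype.ext (by simpa [gen, monomial_mul] using h)⟩
  · rintro ⟨w, h⟩
    exact ⟨w, w.2, by simpa [gen, monomial_mul] using congrArg Subtype.val h⟩

theorem IsStronglyKoszul.pairwise_exchanges (ha : IsHomogeneousConfiguration a)
    (h : IsStronglyKoszul K a) : Pairwise (Exchanges a) := by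
  refine Pairwise.of_lt fun i j hij w hw hdvd => ?_
  obtain ⟨T, hT⟩ := h.colon {i} j (by simpa using hij)
  have divides_iff : ∀ m ∈ expMonoid a,
      Divides a (a i) (m + a j) ↔ ∃ t ∈ T, Divides a (a t) m := by
    intro m hm
    have hmem := SetLike.ext_iff.1 hT (toricMonomial K hm)
    rw [mem_colon_toricGen_iff, mem_span_toricGen_iff, support_toricMonomial] at hmem
    simpa using hmem
  obtain ⟨k, hkT, hkw⟩ := (divides_iff w hw).1 hdvd
  obtain ⟨v, hv, hkv⟩ :=
    (divides_iff (a k) (apply_mem_expMonoid a k)).2 ⟨k, hkT, Divides.refl a _⟩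
  obtain ⟨l, rfl⟩ := ha.exists_eq_of_add_eq_add hv hkv
  exact ⟨k, l, hkw, hkv.symm⟩

theorem span_toricGen_eq (ha : IsHomogeneousConfiguration a) :
    Ideal.span (Set.range (toricGen K a)) = gradedMaximalIdeal K a := by
  ext f
  have hmem : f ∈ gradedMaximalIdeal K a ↔ coeff 0 f.1 = 0 := Iff.rfl
  rw [← Set.image_univ, mem_span_toricGen_iff, hmem]
  constructor
  · intro hf
    by_contra h0
    obtain ⟨s, -, hs⟩ := hf 0 (mem_support_iff.2 h0)
    exact ha.not_divides_zero s hs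
  · intro hf m hm
    obtain rfl | ⟨i, hi⟩ := eq_zero_or_exists_divides (mem_expMonoid_of_mem_support f hm)
    · exact absurd hf (mem_support_iff.1 hm)
    · exact ⟨i, trivial, hi⟩

theorem colon_span_toricGen_eq (h : Pairwise (Exchanges a)) {S : Set (Fin n)} {k : Fin n}
    (hk : k ∉ S) : (Ideal.span (toricGen K a '' S)).colon {toricGen K a k} =
      Ideal.span (toricGen K a '' {t | ∃ s ∈ S, Divides a (a s) (a t + a k)}) := by
  ext f
  rw [mem_colon_toricGen_iff, mem_span_toricGen_iff]
  refine forall₂_congr fun m hm => ⟨?_, ?_⟩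
  · rintro ⟨s, hs, hsm⟩
    obtain ⟨t, l, ht, htl⟩ :=
      h (ne_of_mem_of_not_mem hs hk) m (mem_expMonoid_of_mem_support f hm) hsm
    exact ⟨t, ⟨s, hs, a l, apply_mem_expMonoid a l, htl.symm⟩, ht⟩
  · rintro ⟨t, ⟨s, hs, hst⟩, v, hv, rfl⟩
    exact ⟨s, hs, by simpa only [add_right_comm] using hst.add_right hv⟩

theorem isStronglyKoszul_iff (ha : IsHomogeneousConfiguration a) (hinj : Function.Injective a) :
    IsStronglyKoszul K a ↔ Pairwise (Exchanges a) := by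
  refine ⟨fun h => h.pairwise_exchanges ha, fun h => ⟨span_toricGen_eq ha, fun k hk => ?_,
    fun S k hS => ⟨_, colon_span_toricGen_eq h fun hk => (hS k hk).false⟩⟩⟩
  obtain ⟨s, hs, hsk⟩ := mem_span_toricGen_iff.1 hk (a k) (by simp [toricGen, gen])
  exact hs (hinj (ha.eq_of_divides hsk))

end ToricRing

section ExchangeOrderings

open Finsupp (single weight)

variable {n d : ℕ} {ρ : Equiv.Perm (Fin n)}

theorem IsTwoSmallest.exchanges {G : Type*} [AddCommMonoid G] [IsCancelAdd G] {a : Fin n → G}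
    (ha : IsHomogeneousConfiguration a) {p q : Fin n} (hpq : IsTwoSmallest ρ p q)
    (h : ∀ e, Minimal (IsNonstandard (revLex ρ) a) e → 0 < e q → e.degree = 2) :
    Exchanges a p q := by
  intro w hw hdvd
  obtain ⟨α, rfl, hstd⟩ := exists_weight_eq_not_isNonstandard (m := revLex ρ) hw
  by_cases hαp : 0 < α p
  · exact ⟨p, q, divides_weight hαp, rfl⟩
  have hns : IsNonstandard (revLex ρ) a (single q 1 + α) := by
    refine isNonstandard_of_divides ha (k := p) ?_ fun l hl => ?_
    · rwa [weight_single_one_add, add_comm]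
    · obtain rfl := hpq.eq_of_le hl
      simpa [Finsupp.single_apply, (ne_of_apply_ne ρ hpq.lt.ne')] using hαp
  obtain ⟨g, hg, hmin⟩ := exists_minimal_le_of_wellFoundedLT (IsNonstandard (revLex ρ) a) _ hns
  have hgq : 0 < g q := by
    by_contra hgq
    refine hstd (hmin.prop.mono fun l => ?_)
    obtain rfl | hlq := eq_or_ne l q
    · lia
    · simpa [Finsupp.single_apply, hlq.symm] using hg l
  obtain ⟨-, g', hw', hgp⟩ := hpq.exists_weight_eq_of_minimal ha hmin hgq
  have hdeg := h g hmin hgq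
  obtain ⟨k, rfl⟩ := exists_single_one_add_single_one_eq hdeg hgq
  obtain ⟨l, rfl⟩ := exists_single_one_add_single_one_eq ((ha hw').trans hdeg) hgp
  refine ⟨k, l, divides_weight (Finsupp.single_le_iff.1 (le_of_add_le_add_left hg)), ?_⟩
  simpa only [weight_single_one_add, Finsupp.weight_single, one_smul, add_comm] using hw'.symm

namespace IsExchangeOrdering

variable {K : Type*} [Field K] {a : Fin n → Fin d →₀ ℕ} {i j : Fin n}

theorem isTwoSmallest (ho : IsExchangeOrdering K a i j ρ) : IsTwoSmallest ρ j i where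
  lt := ho.lt
  lt_other l hlj hli := by
    by_cases hl : l ∈ exchangeSet K a i j
    exacts [ho.lt_exchange l hl, ho.lt_other l hli hlj hl]

theorem exists_mem_exchangeSet_pos (ho : IsExchangeOrdering K a i j ρ)
    (ha : IsHomogeneousConfiguration a) (hr : SquaresRigid a) (hx : Pairwise (Exchanges a))
    {α : Fin n →₀ ℕ} (hstd : ¬ IsNonstandard (revLex ρ) a α) (hαj : α j = 0)
    (hdvd : Divides a (a j) (weight a α + a i)) : ∃ m ∈ exchangeSet K a i j, 0 < α m := by
  have not_divides : ¬ Divides a (a j) (weight a α) := fun h =>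
    hstd (isNonstandard_of_divides ha h fun l hl => ho.isTwoSmallest.eq_of_le hl ▸ hαj)
  have hαi : α i = 0 := by
    by_contra hαi
    obtain ⟨β, rfl⟩ := exists_single_one_add_eq (Nat.pos_of_ne_zero hαi)
    rw [weight_single_one_add] at hdvd not_divides
    rw [add_right_comm] at hdvd
    exact not_divides
      (divides_add_of_divides_double_add hx ha hr (weight_mem_expMonoid a β) hdvd)
  obtain ⟨k, l, hk, hkl⟩ :=
    hx (ne_of_apply_ne ρ ho.lt.ne) _ (weight_mem_expMonoid a α) hdvd
  have hkE : k ∈ exchangeSet K a i j := mem_exchangeSet_iff.2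
    ⟨fun h => not_divides (h ▸ hk), a l, apply_mem_expMonoid a l, by rw [add_comm (a i), hkl]⟩
  -- Otherwise every variable of `x^α` would exceed `x_k`, although `u_k` divides `t^(weight a α)`.
  by_contra! hE
  refine hstd (isNonstandard_of_divides ha hk fun l hl => ?_)
  by_cases hlE : l ∈ exchangeSet K a i j
  · exact Nat.le_zero.1 (hE l hlE)
  obtain rfl | hli := eq_or_ne l i
  · exact hαi
  obtain rfl | hlj := eq_or_ne l j
  · exact hαj
  exact absurd hl (ho.exchange_lt_other k hkE l hli hlj hlE).not_ge

theorem degree_eq_two (ho : IsExchangeOrdering K a i j ρ) (ha : IsHomogeneousConfiguration a)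
    (hr : SquaresRigid a) (hx : Pairwise (Exchanges a)) {e : Fin n →₀ ℕ}
    (he : Minimal (IsNonstandard (revLex ρ) a) e) (hpos : 0 < e i) : e.degree = 2 := by
  obtain ⟨hej, e', hw, hj⟩ := ho.isTwoSmallest.exists_weight_eq_of_minimal ha he hpos
  obtain ⟨α, rfl⟩ := exists_single_one_add_eq hpos
  have hstd : ¬ IsNonstandard (revLex ρ) a α := fun hns => by
    simpa using he.le_of_le hns le_add_self i
  have hdvd : Divides a (a j) (weight a α + a i) := by
    rw [add_comm, ← weight_single_one_add, ← hw]
    exact divides_weight hj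
  obtain ⟨m, hm, hαm⟩ := ho.exists_mem_exchangeSet_pos ha hr hx hstd
    (Nat.eq_zero_of_add_eq_zero_left hej) hdvd
  obtain ⟨hmj, hdvd_m⟩ := mem_exchangeSet_iff.1 hm
  have hns : IsNonstandard (revLex ρ) a (single i 1 + single m 1) := by
    refine isNonstandard_of_divides ha (k := j) ?_ fun l hl => ?_
    · rwa [weight_single_one_add, Finsupp.weight_single, one_smul]
    · obtain rfl := ho.isTwoSmallest.eq_of_le hl
      simp [ne_of_apply_ne ρ ho.lt.ne, hmj.symm]
  have hle : single i 1 + single m 1 ≤ single i 1 + α :=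
    add_le_add_right (Finsupp.single_le_iff.2 hαm) _
  rw [← he.eq_of_le hns hle]
  simp

end IsExchangeOrdering

theorem exists_perm_lt_of_lt (f : Fin n → ℕ) :
    ∃ ρ : Equiv.Perm (Fin n), ∀ k l, f k < f l → ρ k < ρ l := by
  refine ⟨(Tuple.sort f).symm, fun k l hkl => ?_⟩
  contrapose! hkl
  simpa using Tuple.monotone_sort f hkl

theorem exists_isExchangeOrdering {K : Type*} [Field K] {a : Fin n → Fin d →₀ ℕ}
    (ha : IsHomogeneousConfiguration a) (hr : SquaresRigid a) {i j : Fin n} (hij : i ≠ j) :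
    ∃ ρ, IsExchangeOrdering K a i j ρ := by
  classical
  have hiE : i ∉ exchangeSet K a i j := by
    rw [mem_exchangeSet_iff]
    rintro ⟨-, v, hv, h⟩
    obtain ⟨l, rfl⟩ := ha.exists_eq_of_add_eq_add hv h
    exact hij (hr i j l h.symm).symm
  obtain ⟨ρ, hρ⟩ := exists_perm_lt_of_lt fun k : Fin n =>
    if k = j then 0 else if k = i then 1 else if k ∈ exchangeSet K a i j then 2 else 3
  have ne_of_mem {k : Fin n} (hk : k ∈ exchangeSet K a i j) : k ≠ j ∧ k ≠ i :=
    ⟨hk.1, ne_of_mem_of_not_mem hk hiE⟩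
  refine ⟨ρ, ⟨hρ _ _ ?_, fun k hk => hρ _ _ ?_, fun l hli hlj hl => hρ _ _ ?_,
    fun k hk l hli hlj hl => hρ _ _ ?_⟩⟩
  · simp [hij]
  · simp [hij, ne_of_mem hk, hk]
  · simp [hij, hli, hlj, hl]
  · simp [ne_of_mem hk, hk, hli, hlj, hl]

end ExchangeOrderings

section Codisjointness

variable {K E : Type*} [Field K] [AddCommGroup E] [Module K E]

theorem disjoint_of_disjoint_of_codisjoint {V N D P : Submodule K E} [FiniteDimensional K V]
    (hVN : Disjoint V N) (hDN : Codisjoint D N) (hDP : Disjoint D P) (hVP : Codisjoint V P) :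
    Disjoint V P := by
  have injective_iff (U W : Submodule K E) :
      Function.Injective (W.mkQ.domRestrict U) ↔ Disjoint U W := by
    rw [LinearMap.injective_domRestrict_iff, W.ker_mkQ]
  have surjective_of {U W : Submodule K E} (h : Codisjoint U W) :
      Function.Surjective (W.mkQ.domRestrict U) := by
    rwa [LinearMap.surjective_domRestrict_iff W.mkQ_surjective, W.ker_mkQ]
  have : FiniteDimensional K (E ⧸ P) := Module.Finite.of_surjective _ (surjective_of hVP)
  have : FiniteDimensional K D := Module.Finite.of_injective _ ((injective_iff D P).2 hDP)
  have : FiniteDimensional K (E ⧸ N) := Module.Finite.of_surjective _ (surjective_of hDN)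
  have finrank_le : Module.finrank K V ≤ Module.finrank K (E ⧸ P) :=
    calc Module.finrank K V
      _ ≤ Module.finrank K (E ⧸ N) :=
        LinearMap.finrank_le_finrank_of_injective ((injective_iff V N).2 hVN)
      _ ≤ Module.finrank K D := LinearMap.finrank_le_finrank_of_surjective (surjective_of hDN)
      _ ≤ Module.finrank K (E ⧸ P) :=
        LinearMap.finrank_le_finrank_of_injective ((injective_iff D P).2 hDP)
  have finrank_eq := finrank_le.antisymm
    (LinearMap.finrank_le_finrank_of_surjective (surjective_of hVP))
  rw [← injective_iff, LinearMap.injective_iff_surjective_of_finrank_eq_finrank finrank_eq]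
  exact surjective_of hVP

end Codisjointness

section AffineForms

variable {ι K R : Type*} [Field K] [CommRing R] [Algebra K R]

/-- The polynomial expressions of degree at most one in the elements `v i`. Those of degree at most
`k` form the power `affineForms K v ^ k`. -/
def affineForms (K : Type*) [Field K] [Algebra K R] (v : ι → R) : Submodule K R :=
  Submodule.span K (insert 1 (Set.range v))

theorem apply_mem_affineForms (v : ι → R) (i : ι) : v i ∈ affineForms K v :=
  Submodule.subset_span (Or.inr ⟨i, rfl⟩)

theorem one_le_affineForms (v : ι → R) : 1 ≤ affineForms K v :=
  Submodule.one_le.2 (Submodule.subset_span (Or.inl rfl))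

theorem algebraMap_mem_affineForms (v : ι → R) (c : K) : algebraMap K R c ∈ affineForms K v :=
  one_le_affineForms v (Submodule.algebraMap_mem c)

theorem map_affineForms {S : Type*} [CommRing S] [Algebra K S] (φ : R →ₐ[K] S) (v : ι → R) :
    (affineForms K v).map φ.toLinearMap = affineForms K fun i => φ (v i) := by
  rw [affineForms, Submodule.map_span, Set.image_insert_eq, ← Set.range_comp]
  simp [affineForms, Function.comp_def]

instance [Finite ι] (v : ι → R) (k : ℕ) :
    FiniteDimensional K (affineForms K v ^ k : Submodule K R) :=
  Module.Finite.iff_fg.2 ((Submodule.fg_span ((Set.finite_range v).insert 1)).pow k)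

theorem sub_algebraMap_mem_ker (ε : R →ₐ[K] K) (x : R) :
    x - algebraMap K R (ε x) ∈ LinearMap.ker ε.toLinearMap := by
  simp

theorem ker_pow_two_le (ε : R →ₐ[K] K) :
    LinearMap.ker ε.toLinearMap ^ 2 ≤ LinearMap.ker ε.toLinearMap := by
  rw [pow_two, Submodule.mul_le]
  intro x hx y _
  rw [LinearMap.mem_ker] at hx ⊢
  simp_all

theorem codisjoint_one_ker (ε : R →ₐ[K] K) : Codisjoint 1 (LinearMap.ker ε.toLinearMap) := by
  rw [codisjoint_iff, eq_top_iff]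
  intro x _
  exact Submodule.mem_sup.2 ⟨_, Submodule.algebraMap_mem (ε x), _, sub_algebraMap_mem_ker ε x,
    add_sub_cancel _ _⟩

theorem codisjoint_affineForms_ker_pow_two {v : ι → R}
    (hv : Algebra.adjoin K (Set.range v) = ⊤) (ε : R →ₐ[K] K) :
    Codisjoint (affineForms K v) (LinearMap.ker ε.toLinearMap ^ 2) := by
  rw [codisjoint_iff, eq_top_iff]
  intro x _
  have hx : x ∈ Algebra.adjoin K (Set.range v) := hv ▸ Algebra.mem_top
  induction hx using Algebra.adjoin_induction with
  | mem _ h =>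
    obtain ⟨i, rfl⟩ := h
    exact Submodule.mem_sup_left (apply_mem_affineForms v i)
  | algebraMap c => exact Submodule.mem_sup_left (algebraMap_mem_affineForms v c)
  | add x y _ _ hx hy => exact add_mem (hx trivial) (hy trivial)
  | mul x y _ _ hx hy =>
    have key : x * y = (ε x • y + ε y • x - algebraMap K R (ε x * ε y)) +
        (x - algebraMap K R (ε x)) * (y - algebraMap K R (ε y)) := by
      simp only [Algebra.smul_def, map_mul]
      ring
    have linear_mem := add_mem (Submodule.smul_mem _ (ε x) (hy trivial))
      (Submodule.smul_mem _ (ε y) (hx trivial))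
    rw [key, pow_two]
    exact add_mem
      (sub_mem (by rwa [pow_two] at linear_mem)
        (Submodule.mem_sup_left (algebraMap_mem_affineForms v _)))
      (Submodule.mem_sup_right (Submodule.mul_mem_mul (sub_algebraMap_mem_ker ε x)
        (sub_algebraMap_mem_ker ε y)))

theorem le_inf_sup_pow_two {P N : Submodule K R} (hN : N ^ 2 ≤ N) (hPN : Codisjoint P (N ^ 2)) :
    N ≤ P ⊓ N ⊔ N ^ 2 := by
  rw [inf_comm, inf_sup_assoc_of_le P hN, codisjoint_iff.1 hPN, inf_top_eq]

theorem pow_le_inf_pow_sup_pow_succ {P N : Submodule K R} (hN : N ^ 2 ≤ N)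
    (hPN : Codisjoint P (N ^ 2)) (k : ℕ) : N ^ k ≤ (P ⊓ N) ^ k ⊔ N ^ (k + 1) := by
  induction k with
  | zero => simp
  | succ k ih =>
    calc N ^ (k + 1)
      _ ≤ ((P ⊓ N) ^ k ⊔ N ^ (k + 1)) * N := by
        rw [pow_succ]
        exact mul_le_mul_left ih N
      _ = (P ⊓ N) ^ k * N ⊔ N ^ (k + 2) := by rw [Submodule.sup_mul, ← pow_succ]
      _ ≤ (P ⊓ N) ^ k * (P ⊓ N ⊔ N ^ 2) ⊔ N ^ (k + 2) := by
        gcongr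
        exact le_inf_sup_pow_two hN hPN
      _ = (P ⊓ N) ^ (k + 1) ⊔ ((P ⊓ N) ^ k * N ^ 2 ⊔ N ^ (k + 2)) := by
        rw [Submodule.mul_sup, ← pow_succ, sup_assoc]
      _ ≤ (P ⊓ N) ^ (k + 1) ⊔ N ^ (k + 2) := by
        gcongr
        rw [pow_add]
        refine sup_le ?_ le_rfl
        gcongr
        exact inf_le_right

theorem codisjoint_pow_pow_succ {P N : Submodule K R} (hP : 1 ≤ P) (hN : N ^ 2 ≤ N)
    (h1N : Codisjoint 1 N) (hPN : Codisjoint P (N ^ 2)) (k : ℕ) :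
    Codisjoint (P ^ k) (N ^ (k + 1)) := by
  induction k with
  | zero => simpa using h1N
  | succ k ih =>
    rw [codisjoint_iff, eq_top_iff, ← codisjoint_iff.1 ih]
    refine sup_le (le_sup_of_le_left (pow_le_pow_right₀ hP k.le_succ)) ?_
    refine (pow_le_inf_pow_sup_pow_succ hN hPN (k + 1)).trans ?_
    gcongr
    exact inf_le_left

theorem codisjoint_affineForms_pow_ker_pow {v : ι → R} (hv : Algebra.adjoin K (Set.range v) = ⊤)
    (ε : R →ₐ[K] K) (k : ℕ) :
    Codisjoint (affineForms K v ^ k) (LinearMap.ker ε.toLinearMap ^ (k + 1)) :=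
  codisjoint_pow_pow_succ (one_le_affineForms v) (ker_pow_two_le ε) (codisjoint_one_ker ε)
    (codisjoint_affineForms_ker_pow_two hv ε) k

end AffineForms

section Truncation

variable {ι K R : Type*} [Field K] [CommRing R] [Algebra K R]

theorem mul_sub_mul_mem_pow_three {N : Submodule K R} {x x₁ y y₁ : R} (hx : x ∈ N)
    (hxx : x - x₁ ∈ N ^ 2) (hy : y₁ ∈ N) (hyy : y - y₁ ∈ N ^ 2) : x * y - x₁ * y₁ ∈ N ^ 3 := by
  have key : x * y - x₁ * y₁ = x * (y - y₁) + (x - x₁) * y₁ := by ring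
  rw [key]
  refine add_mem ?_ ?_
  · rw [pow_succ' N 2]
    exact Submodule.mul_mem_mul hx hyy
  · rw [pow_succ N 2]
    exact Submodule.mul_mem_mul hxx hy

theorem mem_pow_two_or_mem_pow_two_of_mul_mem_pow_three [NoZeroDivisors R] {P N : Submodule K R}
    (hN : N ^ 2 ≤ N) (hPN : Codisjoint P (N ^ 2)) (hdisj : Disjoint (P ^ 2) (N ^ 3)) {y z : R}
    (hy : y ∈ N) (hz : z ∈ N) (hyz : y * z ∈ N ^ 3) : y ∈ N ^ 2 ∨ z ∈ N ^ 2 := by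
  have hle := le_inf_sup_pow_two hN hPN
  obtain ⟨y₁, ⟨hyP, hyN⟩, y₂, hy₂, rfl⟩ := Submodule.mem_sup.1 (hle hy)
  obtain ⟨z₁, ⟨hzP, hzN⟩, z₂, hz₂, rfl⟩ := Submodule.mem_sup.1 (hle hz)
  have mul_mem : y₁ * z₁ ∈ N ^ 3 := by
    rw [← sub_sub_cancel ((y₁ + y₂) * (z₁ + z₂)) (y₁ * z₁)]
    exact sub_mem hyz (mul_sub_mul_mem_pow_three hy (by simpa using hy₂) hzN (by simpa using hz₂))
  have hzero : y₁ * z₁ = 0 :=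
    Submodule.disjoint_def.1 hdisj _ (pow_two P ▸ Submodule.mul_mem_mul hyP hzP) mul_mem
  rcases mul_eq_zero.1 hzero with rfl | rfl
  · exact Or.inl (by rwa [zero_add])
  · exact Or.inr (by rwa [zero_add])

/-- The translates `v i - ε (v i)` of the elements `v i` into the kernel of `ε`. -/
def translate (ε : R →ₐ[K] K) (v : ι → R) (i : ι) : R := v i - algebraMap K R (ε (v i))

theorem translate_mem_ker (ε : R →ₐ[K] K) (v : ι → R) (i : ι) :
    translate ε v i ∈ LinearMap.ker ε.toLinearMap :=
  sub_algebraMap_mem_ker ε (v i)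

theorem translate_mem_affineForms (ε : R →ₐ[K] K) (v : ι → R) (i : ι) :
    translate ε v i ∈ affineForms K v :=
  sub_mem (apply_mem_affineForms v i) (algebraMap_mem_affineForms v _)

theorem translate_mul_self_eq {ε : R →ₐ[K] K} {v : ι → R}
    (hdisj : Disjoint (affineForms K v) (LinearMap.ker ε.toLinearMap ^ 2)) {i k l : ι}
    (h : v i * v i = v k * v l) :
    translate ε v i * translate ε v i = translate ε v k * translate ε v l := by
  rw [← sub_eq_zero]
  refine Submodule.disjoint_def.1 hdisj _ ?_ ?_
  · have key : translate ε v i * translate ε v i - translate ε v k * translate ε v l =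
        ε (v k) • v l + ε (v l) • v k - (2 * ε (v i)) • v i +
          algebraMap K R (ε (v i) * ε (v i) - ε (v k) * ε (v l)) := by
      simp only [translate, Algebra.smul_def, map_sub, map_mul, map_ofNat]
      linear_combination h
    have smul_mem (c : K) (j : ι) : c • v j ∈ affineForms K v :=
      Submodule.smul_mem _ c (apply_mem_affineForms v j)
    rw [key]
    exact add_mem (sub_mem (add_mem (smul_mem _ l) (smul_mem _ k)) (smul_mem _ i))
      (algebraMap_mem_affineForms v _)
  · have mul_mem (j j' : ι) := Submodule.mul_mem_mul (translate_mem_ker ε v j)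
      (translate_mem_ker ε v j')
    rw [pow_two]
    exact sub_mem (mul_mem i i) (mul_mem k l)

end Truncation

section SupportedSubspaces

open Finsupp (single weight)

variable {n d : ℕ} {K : Type*} [Field K] {a : Fin n → Fin d →₀ ℕ}

/-- The exponents of the monomials in the graded maximal ideal of the toric ring. The monomials in
its `k`-th power have the exponents `k • nonzeroExps a` (for `k ≠ 0`). -/
def nonzeroExps (a : Fin n → Fin d →₀ ℕ) : Set (Fin d →₀ ℕ) := (expMonoid a : Set _) \ {0}

/-- The span of the monomials of the toric ring with exponents in `S`. -/
noncomputable def supportedIn (K : Type*) [Field K] (a : Fin n → Fin d →₀ ℕ)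
    (S : Set (Fin d →₀ ℕ)) : Submodule K (toricRing K a) :=
  (restrictSupport K S).comap (toricRing K a).val.toLinearMap

theorem mem_supportedIn {S : Set (Fin d →₀ ℕ)} {f : toricRing K a} :
    f ∈ supportedIn K a S ↔ ∀ m ∈ f.1.support, m ∈ S :=
  Iff.rfl

theorem toricMonomial_mem_supportedIn {S : Set (Fin d →₀ ℕ)} {m : Fin d →₀ ℕ}
    {hm : m ∈ expMonoid a} : toricMonomial K hm ∈ supportedIn K a S ↔ m ∈ S := by
  rw [mem_supportedIn, support_toricMonomial]
  simp

theorem supportedIn_mono {S T : Set (Fin d →₀ ℕ)} (h : S ⊆ T) :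
    supportedIn K a S ≤ supportedIn K a T :=
  Submodule.comap_mono (restrictSupport_mono K h)

theorem mul_mem_supportedIn {S T : Set (Fin d →₀ ℕ)} {f g : toricRing K a}
    (hf : f ∈ supportedIn K a S) (hg : g ∈ supportedIn K a T) :
    f * g ∈ supportedIn K a (S + T) := by
  have h := Submodule.mul_mem_mul (Submodule.mem_comap.1 hf) (Submodule.mem_comap.1 hg)
  rw [← restrictSupport_add] at h
  exact h

theorem supportedIn_pow {S : Set (Fin d →₀ ℕ)} (hS : S ⊆ expMonoid a) (k : ℕ) :
    supportedIn K a S ^ k = supportedIn K a (k • S) := by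
  have map_eq : (supportedIn K a S).map (toricRing K a).val.toLinearMap = restrictSupport K S := by
    rw [supportedIn, Submodule.map_comap_eq, inf_eq_right]
    exact fun f hf => ⟨⟨f, mem_toricRing_iff.2 (restrictSupport_mono K hS hf)⟩, rfl⟩
  symm
  rw [supportedIn, restrictSupport_nsmul, ← map_eq, ← Submodule.map_pow,
    Submodule.comap_map_eq_of_injective Subtype.val_injective]

theorem disjoint_supportedIn {S T : Set (Fin d →₀ ℕ)} (h : Disjoint S T) :
    Disjoint (supportedIn K a S) (supportedIn K a T) := by
  rw [Submodule.disjoint_def]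
  intro f hS hT
  have hsupp : f.1.support = ∅ :=
    Finset.eq_empty_of_forall_notMem fun m hm => Set.disjoint_left.1 h (hS hm) (hT hm)
  exact Subtype.ext (support_eq_empty.1 hsupp)

/-- The evaluation of the toric ring at the origin, whose kernel is the graded maximal ideal. -/
noncomputable def augmentation (K : Type*) [Field K] (a : Fin n → Fin d →₀ ℕ) :
    toricRing K a →ₐ[K] K :=
  (aeval (0 : Fin d → K)).comp (toricRing K a).val

theorem ker_augmentation :
    LinearMap.ker (augmentation K a).toLinearMap = supportedIn K a (nonzeroExps a) := by
  ext f
  have aeval_eq : augmentation K a f = coeff 0 f.1 := by simp [augmentation, constantCoeff_eq]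
  rw [LinearMap.mem_ker, AlgHom.toLinearMap_apply, aeval_eq, mem_supportedIn, ← notMem_support_iff]
  refine ⟨fun h m hm => ⟨mem_expMonoid_of_mem_support f hm, ?_⟩, fun h h0 => (h 0 h0).2 rfl⟩
  rintro rfl
  exact h hm

theorem ker_augmentation_pow (k : ℕ) :
    LinearMap.ker (augmentation K a).toLinearMap ^ k = supportedIn K a (k • nonzeroExps a) := by
  have hA : nonzeroExps a ⊆ expMonoid a := Set.sdiff_subset
  rw [ker_augmentation, supportedIn_pow hA]

theorem nsmul_nonzeroExps_subset (k : ℕ) : k • nonzeroExps a ⊆ expMonoid a := by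
  induction k with
  | zero => simp
  | succ k ih =>
    rw [succ_nsmul]
    rintro _ ⟨x, hx, y, hy, rfl⟩
    exact add_mem (ih hx) hy.1

theorem degree_pos_of_mem_nonzeroExps {m : Fin d →₀ ℕ} (hm : m ∈ nonzeroExps a) :
    0 < m.degree :=
  Nat.pos_of_ne_zero fun h => hm.2 ((Finsupp.degree_eq_zero_iff m).1 h)

-- If `t^y - l` lies in the `k`-th power of the kernel, then `(t^y - l)(t^x - χ(t^x))` lies in the
-- next one.
theorem exists_toricMonomial_sub_mem_ker_pow (χ : toricRing K a →ₐ[K] K) {k : ℕ}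
    {m : Fin d →₀ ℕ} (hm : m ∈ expMonoid a) (hmk : m ∈ k • nonzeroExps a) :
    ∃ l ∈ supportedIn K a {x | x.degree < m.degree},
      toricMonomial K hm - l ∈ LinearMap.ker χ.toLinearMap ^ k := by
  induction k generalizing m with
  | zero =>
    rw [zero_nsmul, Set.mem_zero] at hmk
    subst hmk
    refine ⟨0, zero_mem _, ?_⟩
    rw [sub_zero, pow_zero]
    exact Submodule.one_le.1 le_rfl
  | succ k ih =>
    rw [succ_nsmul] at hmk
    obtain ⟨y, hy, x, hx, rfl⟩ := hmk
    have hyA := nsmul_nonzeroExps_subset k hy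
    have hxpos := degree_pos_of_mem_nonzeroExps hx
    obtain ⟨l, hl, hlk⟩ := ih hyA hy
    set tx := toricMonomial K hx.1
    set ty := toricMonomial K hyA
    have key : toricMonomial K hm - (l * tx + χ tx • (ty - l)) =
        (ty - l) * (tx - algebraMap K _ (χ tx)) := by
      rw [toricMonomial_add hyA hx.1, Algebra.smul_def]
      ring
    refine ⟨l * tx + χ tx • (ty - l), ?_, ?_⟩
    · have hltx := mul_mem_supportedIn hl (toricMonomial_mem_supportedIn (hm := hx.1).2 rfl)
      refine add_mem (supportedIn_mono ?_ hltx) (Submodule.smul_mem _ _ (sub_mem ?_ ?_))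
      · rintro _ ⟨z, hz, _, rfl, rfl⟩
        simpa using hz
      · refine toricMonomial_mem_supportedIn.2 ?_
        simpa using hxpos
      · refine supportedIn_mono (fun z (hz : z.degree < _) => ?_) hl
        simpa using hz.trans_le le_self_add
    · rw [key, pow_succ]
      exact Submodule.mul_mem_mul hlk (sub_algebraMap_mem_ker χ tx)

theorem codisjoint_supportedIn_compl_ker_pow (χ : toricRing K a →ₐ[K] K) (k : ℕ) :
    Codisjoint (supportedIn K a (k • nonzeroExps a)ᶜ) (LinearMap.ker χ.toLinearMap ^ k) := by
  rw [codisjoint_iff, eq_top_iff]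
  set W := supportedIn K a (k • nonzeroExps a)ᶜ ⊔ LinearMap.ker χ.toLinearMap ^ k
  have toricMonomial_mem (N : ℕ) : ∀ m (hm : m ∈ expMonoid a), m.degree = N →
      toricMonomial K hm ∈ W := by
    induction N using Nat.strong_induction_on with
    | _ N ih =>
    rintro m hm rfl
    by_cases hmk : m ∈ k • nonzeroExps a
    · obtain ⟨l, hl, hlk⟩ := exists_toricMonomial_sub_mem_ker_pow χ hm hmk
      rw [← sub_add_cancel (toricMonomial K hm) l]
      exact add_mem (Submodule.mem_sup_right hlk)
        (mem_of_toricMonomial_mem fun m' hm' hml => ih _ (hl hml) m' hm' rfl)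
    · exact Submodule.mem_sup_left (toricMonomial_mem_supportedIn.2 hmk)
  exact fun f _ => mem_of_toricMonomial_mem fun m hm _ => toricMonomial_mem _ m hm rfl

theorem adjoin_range_toricGen : Algebra.adjoin K (Set.range (toricGen K a)) = ⊤ := by
  refine Subalgebra.map_injective (f := (toricRing K a).val) Subtype.val_injective ?_
  rw [AlgHom.map_adjoin, ← Set.range_comp, Algebra.map_top, Subalgebra.range_val]
  rfl

theorem exists_weight_of_mem_nsmul_insert_zero {k : ℕ} {m : Fin d →₀ ℕ}
    (hm : m ∈ k • insert 0 (Set.range a)) : ∃ e, weight a e = m ∧ e.degree ≤ k := by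
  induction k generalizing m with
  | zero =>
    rw [zero_nsmul, Set.mem_zero] at hm
    exact ⟨0, by simp [hm]⟩
  | succ k ih =>
    rw [succ_nsmul'] at hm
    obtain ⟨x, hx, y, hy, rfl⟩ := hm
    obtain ⟨e, rfl, he⟩ := ih hy
    obtain rfl | ⟨i, rfl⟩ := hx
    · exact ⟨e, (zero_add _).symm, he.trans k.le_succ⟩
    · refine ⟨single i 1 + e, weight_single_one_add a i e, ?_⟩
      rw [map_add, Finsupp.degree_single]
      lia

theorem exists_weight_of_mem_nsmul_nonzeroExps {k : ℕ} {m : Fin d →₀ ℕ}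
    (hm : m ∈ k • nonzeroExps a) : ∃ e, weight a e = m ∧ k ≤ e.degree := by
  induction k generalizing m with
  | zero =>
    obtain ⟨e, he⟩ := mem_expMonoid_iff.1 (nsmul_nonzeroExps_subset 0 hm)
    exact ⟨e, he, zero_le⟩
  | succ k ih =>
    rw [succ_nsmul] at hm
    obtain ⟨y, hy, x, ⟨hxA, hx0⟩, rfl⟩ := hm
    obtain ⟨e, rfl, he⟩ := ih hy
    obtain ⟨f, rfl⟩ := mem_expMonoid_iff.1 hxA
    have hf : f.degree ≠ 0 := by
      rw [Ne, Finsupp.degree_eq_zero_iff]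
      rintro rfl
      exact hx0 (map_zero _)
    refine ⟨e + f, map_add _ _ _, ?_⟩
    rw [map_add]
    lia

theorem IsHomogeneousConfiguration.disjoint_nsmul (ha : IsHomogeneousConfiguration a) (k : ℕ) :
    Disjoint (k • insert 0 (Set.range a)) ((k + 1) • nonzeroExps a) := by
  rw [Set.disjoint_left]
  intro m hm hm'
  obtain ⟨e, rfl, he⟩ := exists_weight_of_mem_nsmul_insert_zero hm
  obtain ⟨f, hef, hf⟩ := exists_weight_of_mem_nsmul_nonzeroExps hm'
  have := ha hef
  lia

theorem affineForms_toricGen_pow_le (k : ℕ) :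
    affineForms K (toricGen K a) ^ k ≤ supportedIn K a (k • insert 0 (Set.range a)) := by
  have hA : insert 0 (Set.range a) ⊆ (expMonoid a : Set _) :=
    Set.insert_subset (zero_mem _) (Set.range_subset_iff.2 (apply_mem_expMonoid a))
  rw [← supportedIn_pow hA]
  gcongr
  rw [affineForms, Submodule.span_le]
  rintro _ (rfl | ⟨i, rfl⟩)
  · exact toricMonomial_mem_supportedIn (hm := zero_mem (expMonoid a)).2 (Or.inl rfl)
  · exact toricMonomial_mem_supportedIn (hm := apply_mem_expMonoid a i).2 (Or.inr ⟨i, rfl⟩)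

end SupportedSubspaces

section SquarefreeFactors

theorem associated_of_mul_self_eq_mul {M : Type*} [CommMonoidWithZero M] [IsCancelMulZero M]
    [DecompositionMonoid M] {f g h : M} (hg0 : g ≠ 0) (hg : Squarefree g) (hh : Squarefree h)
    (hfgh : f * f = g * h) : Associated g f := by
  obtain ⟨r, rfl⟩ : g ∣ f :=
    (hg.dvd_pow_iff_dvd two_ne_zero).1 ⟨h, by rw [pow_two, hfgh]⟩
  have hrr : r * r * g = h := mul_left_cancel₀ hg0 (by rw [← hfgh]; ac_rfl)
  exact associated_mul_unit_right g r (hh r ⟨g, hrr.symm⟩)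

variable {σ K : Type*} [Field K]

theorem squarefree_of_degreeOf_le_one {f : MvPolynomial σ K} (h0 : f ≠ 0)
    (hf : ∀ s, degreeOf s f ≤ 1) : Squarefree f := by
  rintro x ⟨y, rfl⟩
  have hxx : x * x ≠ 0 := left_ne_zero_of_mul h0
  have hx : x ≠ 0 := left_ne_zero_of_mul hxx
  have degreeOf_eq_zero (s : σ) : degreeOf s x = 0 := by
    have h := hf s
    rw [degreeOf_mul_eq hxx (right_ne_zero_of_mul h0), degreeOf_mul_eq hx hx] at h
    lia
  have eq_C : x = C (coeff 0 x) := totalDegree_eq_zero_iff_eq_C.1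
    ((totalDegree_eq_zero_iff _ _).2 fun m hm s =>
      Nat.le_zero.1 (degreeOf_le_iff.1 (degreeOf_eq_zero s).le m hm))
  have coeff_ne_zero : coeff 0 x ≠ 0 := fun h => hx (by rw [eq_C, h, C_0])
  rw [eq_C]
  exact coeff_ne_zero.isUnit.map C

theorem exists_eq_smul_of_associated {f g : MvPolynomial σ K} (h : Associated g f) :
    ∃ c : K, f = c • g := by
  obtain ⟨r, rfl⟩ := h
  obtain ⟨c, -, hc⟩ := isUnit_iff_eq_C_of_isReduced.1 r.isUnit
  exact ⟨c, by rw [hc, mul_comm, smul_eq_C_mul]⟩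

end SquarefreeFactors

section Rigidity

variable {n d N e : ℕ} {K : Type*} [Field K] {a : Fin n → Fin d →₀ ℕ} {b : Fin N → Fin e →₀ ℕ}

/-- The exponents of the monomials in the graded maximal ideal that are not products of two such
monomials. -/
def irreducibleExps (b : Fin N → Fin e →₀ ℕ) : Set (Fin e →₀ ℕ) :=
  nonzeroExps b \ 2 • nonzeroExps b

theorem irreducibleExps_subset_range : irreducibleExps b ⊆ Set.range b := by
  rintro m ⟨⟨hmb, hm0⟩, hm2⟩
  rw [Set.mem_singleton_iff] at hm0
  induction hmb using AddSubmonoid.closure_induction_left with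
  | zero => exact absurd rfl hm0
  | add_left x hx y hy ih =>
    obtain ⟨j, rfl⟩ := hx
    obtain rfl | hy0 := eq_or_ne y 0
    · exact ⟨j, (add_zero _).symm⟩
    obtain hj0 | hj0 := eq_or_ne (b j) 0
    · rw [hj0, zero_add] at hm2 ⊢
      exact ih hm2 hy0
    · refine absurd ?_ hm2
      rw [two_nsmul]
      exact Set.add_mem_add ⟨apply_mem_expMonoid b j, hj0⟩ ⟨hy, hy0⟩

/-- `f₁` is the linear part of `f`: it is a combination of irreducible monomials, and `f - f₁` lies
in the square of the graded maximal ideal. -/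
structure IsLinearPart (f f₁ : toricRing K b) : Prop where
  mem_irreducible : f₁ ∈ supportedIn K b (irreducibleExps b)
  sub_mem : f - f₁ ∈ supportedIn K b (2 • nonzeroExps b)

theorem exists_isLinearPart {f : toricRing K b} (hf : f ∈ supportedIn K b (nonzeroExps b)) :
    ∃ f₁, IsLinearPart f f₁ := by
  have hcod := codisjoint_supportedIn_compl_ker_pow (augmentation K b) 2
  have hle := ker_pow_two_le (augmentation K b)
  rw [ker_augmentation_pow] at hcod hle
  rw [ker_augmentation] at hle
  have hf' : f ∈ supportedIn K b (2 • nonzeroExps b)ᶜ ⊔ supportedIn K b (2 • nonzeroExps b) :=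
    codisjoint_iff.1 hcod ▸ Submodule.mem_top
  obtain ⟨f₁, hf₁, f₂, hf₂, rfl⟩ := Submodule.mem_sup.1 hf'
  have hf₁' : f₁ ∈ supportedIn K b (nonzeroExps b) := by simpa using sub_mem hf (hle hf₂)
  exact ⟨f₁, fun m hm => ⟨hf₁' hm, hf₁ hm⟩, by rwa [add_sub_cancel_left]⟩

theorem IsLinearPart.mem_nonzero {f f₁ : toricRing K b} (h : IsLinearPart f f₁) :
    f₁ ∈ supportedIn K b (nonzeroExps b) :=
  supportedIn_mono Set.sdiff_subset h.mem_irreducible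

theorem IsLinearPart.squarefree (hb : ∀ j s, b j s ≤ 1) {f f₁ : toricRing K b}
    (h : IsLinearPart f f₁) (h0 : f₁.1 ≠ 0) : Squarefree f₁.1 := by
  refine squarefree_of_degreeOf_le_one h0 fun s => degreeOf_le_iff.2 fun m hm => ?_
  obtain ⟨j, rfl⟩ := irreducibleExps_subset_range (h.mem_irreducible hm)
  exact hb j s

theorem IsLinearPart.ne_zero {f f₁ : toricRing K b} (h : IsLinearPart f f₁)
    (hf : f ∉ supportedIn K b (2 • nonzeroExps b)) : f₁.1 ≠ 0 := by
  intro h0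
  obtain rfl : f₁ = 0 := Subtype.ext h0
  exact hf (by simpa using h.sub_mem)

variable (φ : toricRing K a ≃ₐ[K] toricRing K b)

theorem codisjoint_affineForms_pow_supportedIn (k : ℕ) :
    Codisjoint (affineForms K (fun i => φ (toricGen K a i)) ^ k)
      (supportedIn K b ((k + 1) • nonzeroExps b)) := by
  rw [← ker_augmentation_pow]
  refine codisjoint_affineForms_pow_ker_pow ?_ (augmentation K b) k
  have hrange : (Set.range fun i => φ (toricGen K a i)) =
      φ.toAlgHom '' Set.range (toricGen K a) := by
    rw [← Set.range_comp]
    rfl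
  rw [hrange, ← AlgHom.map_adjoin, adjoin_range_toricGen, Algebra.map_top, AlgHom.range_eq_top]
  exact φ.surjective

variable (ha : IsHomogeneousConfiguration a)
include ha

theorem IsHomogeneousConfiguration.disjoint_affineForms_pow_supportedIn (k : ℕ) :
    Disjoint (affineForms K (fun i => φ (toricGen K a i)) ^ k)
      (supportedIn K b ((k + 1) • nonzeroExps b)) := by
  have hdisj : Disjoint (affineForms K (toricGen K a) ^ k)
      (LinearMap.ker (augmentation K a).toLinearMap ^ (k + 1)) := by
    rw [ker_augmentation_pow]
    exact (disjoint_supportedIn (ha.disjoint_nsmul k)).mono_left (affineForms_toricGen_pow_le k)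
  set χ : toricRing K b →ₐ[K] K := (augmentation K a).comp φ.symm.toAlgHom
  have map_ker : (LinearMap.ker (augmentation K a).toLinearMap).map φ.toAlgHom.toLinearMap =
      LinearMap.ker χ.toLinearMap := by
    ext x
    refine ⟨?_, fun hx => ⟨φ.symm x, hx, φ.apply_symm_apply x⟩⟩
    rintro ⟨y, hy, rfl⟩
    simpa [χ] using hy
  have hdisj' := Submodule.disjoint_map (f := φ.toAlgHom.toLinearMap) φ.injective hdisj
  rw [Submodule.map_pow, Submodule.map_pow, map_affineForms, map_ker] at hdisj'
  exact disjoint_of_disjoint_of_codisjoint hdisj' (codisjoint_supportedIn_compl_ker_pow χ (k + 1))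
    (disjoint_supportedIn disjoint_compl_left) (codisjoint_affineForms_pow_supportedIn φ k)

include φ

theorem IsHomogeneousConfiguration.disjoint_nsmul_irreducibleExps :
    Disjoint (2 • irreducibleExps b) (3 • nonzeroExps b) := by
  rw [Set.disjoint_left, two_nsmul]
  rintro _ ⟨x, ⟨hx, hx2⟩, y, ⟨hy, hy2⟩, rfl⟩ hxy
  have hle := ker_pow_two_le (augmentation K b)
  have hcod := codisjoint_affineForms_pow_supportedIn φ 1
  have hdisj := ha.disjoint_affineForms_pow_supportedIn φ 2
  rw [← ker_augmentation_pow] at hcod hdisj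
  rw [pow_one] at hcod
  have hker (x : Fin e →₀ ℕ) (hx : x ∈ nonzeroExps b) :
      toricMonomial K hx.1 ∈ LinearMap.ker (augmentation K b).toLinearMap := by
    rw [ker_augmentation]
    exact toricMonomial_mem_supportedIn.2 hx
  have hmul : toricMonomial K hx.1 * toricMonomial K hy.1 ∈
      LinearMap.ker (augmentation K b).toLinearMap ^ 3 := by
    rw [ker_augmentation_pow, ← toricMonomial_add]
    exact toricMonomial_mem_supportedIn.2 hxy
  have hor := mem_pow_two_or_mem_pow_two_of_mul_mem_pow_three hle hcod hdisj (hker x hx)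
    (hker y hy) hmul
  rw [ker_augmentation_pow, toricMonomial_mem_supportedIn, toricMonomial_mem_supportedIn] at hor
  exact hor.elim hx2 hy2

theorem IsLinearPart.mul_self_eq_mul {f g h f₁ g₁ h₁ : toricRing K b}
    (hf : f ∈ supportedIn K b (nonzeroExps b)) (hg : g ∈ supportedIn K b (nonzeroExps b))
    (hf₁ : IsLinearPart f f₁) (hg₁ : IsLinearPart g g₁) (hh₁ : IsLinearPart h h₁)
    (hfgh : f * f = g * h) : f₁ * f₁ = g₁ * h₁ := by
  have mul_sub_mul_mem {x x₁ y y₁ : toricRing K b} (hx : x ∈ supportedIn K b (nonzeroExps b))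
      (hx₁ : IsLinearPart x x₁) (hy₁ : IsLinearPart y y₁) :
      x * y - x₁ * y₁ ∈ supportedIn K b (3 • nonzeroExps b) := by
    have hxx := hx₁.sub_mem
    have hyy := hy₁.sub_mem
    have hy := hy₁.mem_nonzero
    rw [← ker_augmentation_pow] at hxx hyy ⊢
    rw [← ker_augmentation] at hx hy
    exact mul_sub_mul_mem_pow_three hx hxx hy hyy
  have mul_mem {x x₁ y y₁ : toricRing K b} (hx₁ : IsLinearPart x x₁) (hy₁ : IsLinearPart y y₁) :
      x₁ * y₁ ∈ supportedIn K b (2 • irreducibleExps b) :=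
    two_nsmul (irreducibleExps b) ▸ mul_mem_supportedIn hx₁.mem_irreducible hy₁.mem_irreducible
  refine sub_eq_zero.1 (Submodule.disjoint_def.1
    (disjoint_supportedIn (ha.disjoint_nsmul_irreducibleExps φ)) _
    (Submodule.sub_mem _ (mul_mem hf₁ hf₁) (mul_mem hg₁ hh₁)) ?_)
  have key : f₁ * f₁ - g₁ * h₁ = (g * h - g₁ * h₁) - (f * f - f₁ * f₁) := by
    rw [hfgh]
    ring
  rw [key]
  exact Submodule.sub_mem _ (mul_sub_mul_mem hg hg₁ hh₁) (mul_sub_mul_mem hf hf₁ hf₁)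

theorem IsHomogeneousConfiguration.exists_sub_smul_mem_of_mul_self_eq_mul
    (hb : ∀ j s, b j s ≤ 1) {f g h : toricRing K b}
    (hf : f ∈ supportedIn K b (nonzeroExps b)) (hg : g ∈ supportedIn K b (nonzeroExps b))
    (hh : h ∈ supportedIn K b (nonzeroExps b)) (hg2 : g ∉ supportedIn K b (2 • nonzeroExps b))
    (hh2 : h ∉ supportedIn K b (2 • nonzeroExps b)) (hfgh : f * f = g * h) :
    ∃ c : K, f - c • g ∈ supportedIn K b (2 • nonzeroExps b) := by
  obtain ⟨f₁, hf₁⟩ := exists_isLinearPart hf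
  obtain ⟨g₁, hg₁⟩ := exists_isLinearPart hg
  obtain ⟨h₁, hh₁⟩ := exists_isLinearPart hh
  have hg0 := hg₁.ne_zero hg2
  have linear_eq : f₁.1 * f₁.1 = g₁.1 * h₁.1 :=
    congrArg Subtype.val (IsLinearPart.mul_self_eq_mul φ ha hf hg hf₁ hg₁ hh₁ hfgh)
  obtain ⟨c, hc⟩ := exists_eq_smul_of_associated (associated_of_mul_self_eq_mul hg0
    (hg₁.squarefree hb hg0) (hh₁.squarefree hb (hh₁.ne_zero hh2)) linear_eq)
  obtain rfl : f₁ = c • g₁ := Subtype.ext hc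
  refine ⟨c, ?_⟩
  rw [← sub_sub_sub_cancel_right f (c • g) (c • g₁), ← smul_sub]
  exact sub_mem hf₁.sub_mem (Submodule.smul_mem _ c hg₁.sub_mem)

omit φ in
theorem IsHomogeneousConfiguration.toricGen_sub_smul_ne_algebraMap (hinj : Function.Injective a)
    {x y : Fin n} (hxy : x ≠ y) (c c' : K) :
    toricGen K a x - c • toricGen K a y ≠ algebraMap K (toricRing K a) c' := by
  intro h
  have hcoeff := congrArg (fun f : toricRing K a => coeff (a x) f.1) h
  have hC : (algebraMap K (toricRing K a) c').1 = C c' := rfl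
  simp [hC, coeff_monomial, coeff_C, hinj.ne hxy.symm, (ha.apply_ne_zero x).symm] at hcoeff

theorem IsHomogeneousConfiguration.translate_sub_smul_notMem (hinj : Function.Injective a)
    {x y : Fin n} (hxy : x ≠ y) (c : K) :
    translate (augmentation K b) (fun i => φ (toricGen K a i)) x -
      c • translate (augmentation K b) (fun i => φ (toricGen K a i)) y ∉
        supportedIn K b (2 • nonzeroExps b) := by
  intro hmem
  have hdisj := ha.disjoint_affineForms_pow_supportedIn φ 1
  rw [pow_one] at hdisj
  have hzero := Submodule.disjoint_def.1 hdisj _ (sub_mem (translate_mem_affineForms _ _ x)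
    (Submodule.smul_mem _ c (translate_mem_affineForms _ _ y))) hmem
  refine ha.toricGen_sub_smul_ne_algebraMap hinj hxy c
    (augmentation K b (φ (toricGen K a x)) - c * augmentation K b (φ (toricGen K a y)))
    (φ.injective ?_)
  rw [map_sub, map_smul, AlgEquiv.commutes, map_sub, map_mul, ← sub_eq_zero, ← hzero]
  simp only [translate, Algebra.smul_def]
  ring

omit φ

theorem IsHomogeneousConfiguration.squaresRigid_of_isSquarefreeToric (hinj : Function.Injective a)
    (hsq : IsSquarefreeToric K a) : SquaresRigid a := by
  obtain ⟨N, e, b, hb, ⟨φ⟩⟩ := hsq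
  intro i k l hikl
  by_contra hki
  have hli : l ≠ i := by
    rintro rfl
    exact hki (hinj (add_right_cancel hikl)).symm
  have toricGen_eq : toricGen K a i * toricGen K a i = toricGen K a k * toricGen K a l :=
    Subtype.ext (by simp [monomial_mul, hikl])
  set g := translate (augmentation K b) fun i => φ (toricGen K a i)
  have translate_eq : g i * g i = g k * g l := by
    have hdisj := ha.disjoint_affineForms_pow_supportedIn φ 1
    rw [pow_one, ← ker_augmentation_pow] at hdisj
    exact translate_mul_self_eq hdisj (by simp only [← map_mul, toricGen_eq])
  have translate_mem (j : Fin n) : g j ∈ supportedIn K b (nonzeroExps b) :=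
    ker_augmentation (K := K) (a := b) ▸ translate_mem_ker _ _ j
  have notMem {x y : Fin n} (hxy : x ≠ y) := ha.translate_sub_smul_notMem φ hinj hxy
  have notMem_square {x : Fin n} (hx : x ≠ i) : g x ∉ supportedIn K b (2 • nonzeroExps b) := by
    simpa using notMem hx 0
  obtain ⟨c, hc⟩ := ha.exists_sub_smul_mem_of_mul_self_eq_mul φ hb (translate_mem i)
    (translate_mem k) (translate_mem l) (notMem_square hki) (notMem_square hli) translate_eq
  exact notMem (Ne.symm hki) c hc

end Rigidity

end StronglyKoszulToric

open StronglyKoszulToric in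
theorem theorem2p3_general {K : Type*} [Field K] {n d : ℕ} {a : Fin n → Fin d →₀ ℕ}
    (ha : IsHomogeneousConfiguration a) (hr : SquaresRigid a) :
    (IsStronglyKoszul K a → ∀ i j : Fin n, i < j → ∀ ρ : Equiv.Perm (Fin n),
      IsExchangeOrdering K a i j ρ → QuadraticAt K a ρ i) ∧
    (IsStronglyKoszul K a ↔ ∀ i j : Fin n, i < j → ∃ (ρ : Equiv.Perm (Fin n)) (p q : Fin n),
      ({p, q} : Set (Fin n)) = {i, j} ∧ (ρ p : ℕ) = 0 ∧ (ρ q : ℕ) = 1 ∧ QuadraticAt K a ρ q) := by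
  have quadraticAt (h : IsStronglyKoszul K a) {i j : Fin n} {ρ : Equiv.Perm (Fin n)}
      (ho : IsExchangeOrdering K a i j ρ) : QuadraticAt K a ρ i :=
    quadraticAt_iff.2 fun _ => ho.degree_eq_two ha hr (h.pairwise_exchanges ha)
  refine ⟨fun h i j _ ρ ho => quadraticAt h ho, fun h i j hij => ?_, fun h => ?_⟩
  · obtain ⟨ρ, ho⟩ := exists_isExchangeOrdering (K := K) ha hr hij.ne
    obtain ⟨hj, hi⟩ := isTwoSmallest_iff.1 ho.isTwoSmallest
    exact ⟨ρ, j, i, Set.pair_comm j i, hj, hi, quadraticAt h ho⟩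
  · refine (isStronglyKoszul_iff ha hr.injective).2 (Pairwise.of_lt fun i j hij => ?_)
    obtain ⟨ρ, p, q, hpq, hp, hq, hquad⟩ := h i j hij
    have hx := (isTwoSmallest_iff.2 ⟨hp, hq⟩).exchanges ha (quadraticAt_iff.1 hquad)
    obtain ⟨rfl, rfl⟩ | ⟨rfl, rfl⟩ := Set.pair_eq_pair_iff.1 hpq
    exacts [hx, hx.symm]

theorem theorem2p3 {K : Type*} [Field K] {n d δ : ℕ} (hδ : 0 < δ) (a : Fin n → Fin d →₀ ℕ)
    (ha : Function.Injective a) (hdeg : ∀ i, (a i).degree = δ)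
    (hsq : StronglyKoszulToric.IsSquarefreeToric K a) :
    (StronglyKoszulToric.IsStronglyKoszul K a →
      ∀ i j : Fin n, i < j → ∀ ρ : Equiv.Perm (Fin n),
        StronglyKoszulToric.IsExchangeOrdering K a i j ρ →
          StronglyKoszulToric.QuadraticAt K a ρ i) ∧
    (StronglyKoszulToric.IsStronglyKoszul K a ↔
      ∀ i j : Fin n, i < j → ∃ (ρ : Equiv.Perm (Fin n)) (p q : Fin n),
        ({p, q} : Set (Fin n)) = {i, j} ∧ (ρ p : ℕ) = 0 ∧ (ρ q : ℕ) = 1 ∧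
          StronglyKoszulToric.QuadraticAt K a ρ q) := by
  have hconf := StronglyKoszulToric.isHomogeneousConfiguration_of_degree_eq hδ hdeg
  exact theorem2p3_general hconf (hconf.squaresRigid_of_isSquarefreeToric ha hsq)
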